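/- **Setting.** Let $N, D$ be integers with $1\le D<N$, and let $0<\lambda<1$. A system consists of $N$ parallel servers of unit speed and one dispatcher. Tasks arrive at the dispatcher as a Poisson process of rate $\lambda N$. At each arrival a set of $D$ servers is sampled uniformly at random, and the task is sent immediately to the sampled server with the smallest number of tasks; ties are broken uniformly at random. The service requirements of the arriving tasks are i.i.d. with an arbitrary law on $[0,\infty)$; each may come with a real-valued mark that the policy may use, the pairs (requirement, mark) being i.i.d. The arrival times, the samplings, the tie-breakings and these pairs are independent. All servers use the same local service policy: an arbitrary, measurable, non-anticipating and work-conserving rule that decides, from the arrival times, requirements and marks of the tasks routed to that server, how much service each of these tasks has received up to each time; the server delivers at most one unit of service per unit of time, and exactly one as long as it holds an uncompleted task. Let $\Lambda_N=(\mathbb Z_+)^N$ with $\mathbb Z_+=\{0,1,2,\dots\}$. For $\xi\in\Lambda_N$ the system starts with $\xi(i)$ tasks at server $i$. Their residual service requirements are positive and, together with their marks, have arbitrary laws (in particular, they may be deterministic); these data are independent for distinct servers and independent of everything that concerns the arriving tasks. Let $X^N_t(i)$ be the number of uncompleted tasks at server $i$ at time $t$, and let $$\pi^N_k(t)=\#\{\,i\in\{1,\dots,N\}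 : X^N_t(i)\ge k\,\},\qquad k\in\mathbb Z_+ .$$ Write $\mathbb E_\xi$ for the expectation for the system started from $\xi$, and $$u_N(t)=\exp\Big(\frac{2^{D-1}\lambda D N}{N-D}\,t\Big).$$ **Proposition.** For every $\xi\in\Lambda_N$, every $t\ge 0$ and all $k,l\in\mathbb Z_+$, the expectations below are well defined and $$\Big|\mathbb E_\xi\big[\pi^N_k(t)\,\pi^N_l(t)\big]-\mathbb E_\xi\big[\pi^N_k(t)\big]\,\mathbb E_\xi\big[\pi^N_l(t)\big]\Big|\le \frac{2(3/2)^D N^2(N-1)}{N-D}\left[N\ln\Big(\frac{N+u_N(t)-1}{N}\Big)-\frac{(N-1)(u_N(t)-1)}{N+u_N(t)-1}\right]+N .$$ In particular the bound is uniform over the initial configuration $\xi$, the law of the service requirements and the service policy. -/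

import Mathlib

open MeasureTheory ProbabilityTheory
open scoped NNReal

namespace JSQ

/-- A task as seen by the server that processes it: its arrival time, its service requirement, and
an additional mark that a policy may use (for instance to randomise, or to record attributes of the
task that are not contained in the other two entries). -/
abbrev Task := ℝ × ℝ≥0 × ℝ

/-- The arrival time of a task. -/
def Task.arrival (x : Task) : ℝ := x.1

/-- The service requirement of a task. -/
def Task.size (x : Task) : ℝ := (x.2.1 : ℝ)

/-- The list of tasks is in order of arrival, and no task arrives before time `0`. -/
def IsInput (L : List Task) : Prop :=
  (∀ x ∈ L, 0 ≤ x.arrival) ∧ L.Pairwise (fun x y => x.arrival ≤ y.arrival)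

open Classical in
/-- If `S j t` is the amount of service received up to time `t` by the `j`-th task of `L`, this is
the number of tasks of `L` which have arrived by time `t` and are not completed at time `t`. -/
noncomputable def numPresent (S : ℕ → ℝ → ℝ) (L : List Task) (t : ℝ) : ℕ :=
  (Finset.univ.filter
    (fun j : Fin L.length => (L.get j).arrival ≤ t ∧ S j t < (L.get j).size)).card

/-- A local, work-conserving service policy of a server of unit speed. When the tasks routed to
the server are `L`, listed in order of arrival, `served L j t` is the amount of service that the
`j`-th of them has received up to time `t`. -/
structure ServicePolicy where
  served : List Task → ℕ → ℝ → ℝ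
  measurable_served : ∀ m j : ℕ,
    Measurable (fun p : (Fin m → Task) × ℝ => served (List.ofFn p.1) j p.2)
  /-- A task is not served before its arrival. -/
  served_eq_zero : ∀ L, IsInput L → ∀ j : Fin L.length, ∀ t ≤ (L.get j).arrival,
    served L j t = 0
  monotone_served : ∀ L, IsInput L → ∀ j : Fin L.length, Monotone (served L j)
  /-- A task never receives more service than it requires. -/
  served_le_size : ∀ L, IsInput L → ∀ j : Fin L.length, ∀ t, served L j t ≤ (L.get j).size
  /-- The policy does not anticipate future arrivals. -/
  causal : ∀ L x, IsInput (L ++ [x]) → ∀ j : Fin L.length, ∀ t ≤ x.arrival,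
    served (L ++ [x]) j t = served L j t
  /-- The server has unit speed: it delivers at most `t - s` units of service in `[s, t]`. -/
  unit_speed : ∀ L, IsInput L → ∀ s t, 0 ≤ s → s ≤ t →
    ∑ j : Fin L.length, (served L j t - served L j s) ≤ t - s
  /-- The server works at full speed as long as some task is present. -/
  work_conserving : ∀ L, IsInput L → ∀ s t, 0 ≤ s → s ≤ t →
    (∀ r, s ≤ r → r < t → 0 < numPresent (served L) L r) →
    ∑ j : Fin L.length, (served L j t - served L j s) = t - s

/-- The number of tasks present at time `t` at a server to which the tasks `L` were routed. -/
noncomputable def ServicePolicy.queueLength (pol : ServicePolicy) (L : List Task) (t : ℝ) : ℕ :=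
  numPresent (pol.served L) L t

/-- Permutations of a finite set carry the discrete σ-algebra. -/
instance permMeasurableSpace (N : ℕ) : MeasurableSpace (Equiv.Perm (Fin N)) := ⊤

/-- The random input attached to one arrival at the dispatcher: the time elapsed since the previous
arrival, the set of sampled servers, a ranking of the servers used to break ties, the service
requirement of the task, and its mark. -/
abbrev ArrivalData (N : ℕ) := ℝ × Finset (Fin N) × Equiv.Perm (Fin N) × ℝ≥0 × ℝ

/-- The law of the input of one arrival: an exponential interarrival time of rate `lam * N`, a
uniformly random set of `D` servers, a uniformly random ranking of the servers, and a service
requirement with mark of law `ν`, all independent. -/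
noncomputable def arrivalLaw (N D : ℕ) (lam : ℝ) (ν : Measure (ℝ≥0 × ℝ)) :
    Measure (ArrivalData N) :=
  (expMeasure (lam * N)).prod
    ((uniformOn {S : Finset (Fin N) | S.card = D}).prod
      ((uniformOn (Set.univ : Set (Equiv.Perm (Fin N)))).prod ν))

/-- Server `i` is the one that receives the task when the queue lengths are `q`, the sampled servers
are `S` and ties are broken by the ranking `σ`: it has the shortest queue in `S` and, among those
with the shortest queue, the lowest rank. -/
def IsSelected {N : ℕ} (q : Fin N → ℕ) (S : Finset (Fin N)) (σ : Equiv.Perm (Fin N))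
    (i : Fin N) : Prop :=
  i ∈ S ∧ ∀ j ∈ S, q i < q j ∨ (q i = q j ∧ σ i ≤ σ j)

section Dynamics

variable {N : ℕ} (pol : ServicePolicy) (ξ : Fin N → ℕ)

/-- Service requirements and marks of the tasks present at time `0` in the configuration `ξ`. -/
abbrev InitialData (ξ : Fin N → ℕ) := (i : Fin N) → Fin (ξ i) → ℝ≥0 × ℝ

/-- The time of the arrival with index `n` (the first arrival has index `0`). -/
def arrivalTime (z : ℕ → ArrivalData N) (n : ℕ) : ℝ :=
  ∑ m ∈ Finset.range (n + 1), (z m).1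

/-- The number of arrivals in the time interval `[0, t]`. -/
noncomputable def arrivalCount (z : ℕ → ArrivalData N) (t : ℝ) : ℕ :=
  {n : ℕ | arrivalTime z n ≤ t}.ncard

open Classical in
/-- `routed pol ξ y z n i` lists the tasks initially present at server `i` followed by those among
the first `n` arrivals that the dispatcher sent to server `i`. -/
noncomputable def routed (y : InitialData ξ) (z : ℕ → ArrivalData N) :
    ℕ → Fin N → List Task
  | 0, i => List.ofFn (fun m => ((0 : ℝ), y i m))
  | n + 1, i =>
    if IsSelected (fun j => pol.queueLength (routed y z n j) (arrivalTime z n))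
        (z n).2.1 (z n).2.2.1 i
    then routed y z n i ++ [(arrivalTime z n, (z n).2.2.2)]
    else routed y z n i

/-- The number of tasks at server `i` at time `t`. -/
noncomputable def queue (y : InitialData ξ) (z : ℕ → ArrivalData N) (t : ℝ) (i : Fin N) : ℕ :=
  pol.queueLength (routed pol ξ y z (arrivalCount z t) i) t

end Dynamics

/-- The number of servers with at least `k` tasks in the configuration `x`. -/
def tailCount {N : ℕ} (x : Fin N → ℕ) (k : ℕ) : ℕ :=
  (Finset.univ.filter (fun i => k ≤ x i)).card

/-- The random variables that drive the system started from `ξ`, on a probability space `(Ω, P)`: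
`Z n` is the input of the arrival with index `n`, and `Y i` contains the (residual) service
requirements and the marks of the tasks present at server `i` at time `0`. The inputs of the
arrivals are i.i.d.; the initial tasks have positive requirements of arbitrary laws, independent
for distinct servers, and independent of the arrivals. -/
structure IsDriving {N : ℕ} (D : ℕ) (lam : ℝ) (ν : Measure (ℝ≥0 × ℝ)) (ξ : Fin N → ℕ)
    {Ω : Type*} [MeasurableSpace Ω] (P : Measure Ω)
    (Z : ℕ → Ω → ArrivalData N) (Y : (i : Fin N) → Ω → (Fin (ξ i) → ℝ≥0 × ℝ)) : Prop where
  measurable_arrivals : ∀ n, Measurable (Z n)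
  measurable_initial : ∀ i, Measurable (Y i)
  law_arrivals : ∀ n, HasLaw (Z n) (arrivalLaw N D lam ν) P
  indep_arrivals : iIndepFun Z P
  indep_initial : iIndepFun Y P
  indep_initial_arrivals : IndepFun (fun ω i => Y i ω) (fun ω n => Z n ω) P
  initial_pos : ∀ i m, ∀ᵐ ω ∂P, 0 < (Y i ω m).1

/-- The process `t ↦ π_k(t)`: the number of servers with at least `k` tasks at time `t`. -/
noncomputable def tailProcess {N : ℕ} (pol : ServicePolicy) (ξ : Fin N → ℕ) {Ω : Type*}
    (Z : ℕ → Ω → ArrivalData N) (Y : (i : Fin N) → Ω → (Fin (ξ i) → ℝ≥0 × ℝ))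
    (k : ℕ) (t : ℝ) (ω : Ω) : ℝ :=
  (tailCount (queue pol ξ (fun i => Y i ω) (fun n => Z n ω) t) k : ℝ)

/-- `u_N(t) = exp (2^(D-1) λ D N t / (N - D))`. -/
noncomputable def uFun (N D : ℕ) (lam t : ℝ) : ℝ :=
  Real.exp ((2 : ℝ) ^ (D - 1) * lam * D * N / ((N : ℝ) - D) * t)

end JSQ

/-! The system is unfolded backwards from the latest arrival. Fix the observation time `t` and
regard the indicators that servers have at least `k` or `l` tasks at time `t` as functions of a
finite list of arrivals, latest first, and of the initial tasks. `evolve` at horizon `s` takes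
expectations when only the arrivals in `[0, s]` are fed into such a function, while the time `t`
inside it stays frozen. No Markov property and no residual work is needed: the queue at a server is
a function of the list of tasks routed to it. Hence the uniformity in the policy, the service law
and the initial state.

Write `r` for the arrival rate and `f^m` for the function obtained from `f` by prescribing a latest
arrival with mark `m`. Conditioning on the latest point of the Poisson process gives a renewal
equation for expectations (`exp_mul_evolve`). Together with a product rule it gives one for
covariances (`exp_mul_evolveCov`), whose integrand is `Cov(f^m, g^m) + (E f^m - E f)(E g^m - E g)`.

Let `f` depend on the servers in `A` and `g` on those in a disjoint set `B`, and let `S` be the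
sampled set. If `S` misses `A`, then `f^m = f`; otherwise `f^m` depends on `A ∪ S`. So the groups
remain disjoint, and the product vanishes, unless `S` meets both; then the trivial bound `2` is
used. A set `S` containing two given servers has probability of order `1/N²`, so the groups grow
slowly, at a rate proportional to `a (N - a)` for a group of size `a`.

This suggests comparing the covariance with `K(a, b, s) = C ∫ x_a x_b` over `[0, s]`, where `x_a`
solves the logistic equation `x' = c x (1 - x/N)` from `a`. Concavity of `x_a` in `a` controls the
growth of the groups, and the flow identity for the logistic equation makes `K` a supersolution
(`covBound_supersolution`). Picard iteration turns this into the bound `abs_evolveCov_le`. Finally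
the covariance of the counts is summed over pairs of servers: the `N` diagonal pairs contribute at
most `1` each, the others at most `K(1, 1, t)`, which is explicit. -/

namespace JSQ

/-! ### Measurability of functions of finite lists -/

section ListMeasurability

variable {α β γ : Type*} [MeasurableSpace α] [MeasurableSpace β] [MeasurableSpace γ]

/-- Finite lists carry the σ-algebra of the disjoint union of the powers of `α`. -/
instance listMeasurableSpace {α : Type*} [MeasurableSpace α] : MeasurableSpace (List α) :=
  ⨅ n : ℕ, MeasurableSpace.map (fun v : Fin n → α => List.ofFn v) inferInstance

lemma measurableSet_list {s : Set (List α)} :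
    MeasurableSet s ↔ ∀ n : ℕ, MeasurableSet {v : Fin n → α | List.ofFn v ∈ s} := by
  simp only [MeasurableSpace.measurableSet_iInf]
  rfl

lemma measurable_ofFn (n : ℕ) : Measurable (fun v : Fin n → α => List.ofFn v) :=
  fun _ hs => measurableSet_list.1 hs n

lemma measurable_from_list {f : List α → β}
    (hf : ∀ n : ℕ, Measurable (fun v : Fin n → α => f (List.ofFn v))) : Measurable f :=
  fun _ hs => measurableSet_list.2 fun n => hf n hs

lemma measurable_list_length : Measurable (List.length : List α → ℕ) :=
  measurable_from_list fun n => by simp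

lemma measurable_list_getD (a : α) (k : ℕ) : Measurable (fun L : List α => L.getD k a) :=
  measurable_from_list fun n => by
    by_cases h : k < n
    · have : (fun v : Fin n → α => (List.ofFn v).getD k a) = fun v => v ⟨k, h⟩ := by
        ext v; simp [List.getD, h]
      rw [this]; exact measurable_pi_apply _
    · have : (fun v : Fin n → α => (List.ofFn v).getD k a) = fun v => a := by
        ext v; simp [List.getD, h]
      rw [this]; exact measurable_const

/-- A function of a list and a parameter is jointly measurable if it is so on lists of each fixed
length. -/
lemma measurable_from_list_prod [Nonempty α] {f : List α × γ → β}
    (hf : ∀ n : ℕ, Measurable (fun p : (Fin n → α) × γ => f (List.ofFn p.1, p.2))) :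
    Measurable f := by
  intro s hs
  obtain ⟨a⟩ := ‹Nonempty α›
  -- The default `a` is never read where it matters: `r n` is applied only to lists of length `n`,
  -- on which it inverts `List.ofFn`. Its measurability transfers the hypothesis to the product
  -- σ-algebra.
  let r (n : ℕ) (p : List α × γ) : (Fin n → α) × γ := (fun k => p.1.getD k a, p.2)
  have hr (n : ℕ) : Measurable (r n) :=
    Measurable.prodMk (measurable_pi_lambda _ fun k : Fin n =>
      (measurable_list_getD a (k : ℕ)).comp measurable_fst) measurable_snd
  have : f ⁻¹' s = ⋃ n : ℕ, ((fun p : List α × γ => p.1.length) ⁻¹' {n}) ∩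
      r n ⁻¹' ((fun p : (Fin n → α) × γ => f (List.ofFn p.1, p.2)) ⁻¹' s) := by
    ext ⟨L, c⟩
    have key : List.ofFn (fun k : Fin L.length => L.getD k a) = L := by
      apply List.ext_getElem <;> simp
    simp only [Set.mem_preimage, Set.mem_iUnion, Set.mem_inter_iff, Set.mem_singleton_iff, r]
    constructor
    · intro h
      exact ⟨L.length, rfl, by rwa [key]⟩
    · rintro ⟨n, rfl, h⟩
      rwa [key] at h
  rw [this]
  refine MeasurableSet.iUnion fun n => MeasurableSet.inter ?_ (hr n (hf n hs))
  exact (measurable_list_length.comp measurable_fst) (MeasurableSet.singleton n)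

lemma measurable_cons [Nonempty α] : Measurable (fun p : List α × α => p.2 :: p.1) := by
  refine measurable_from_list_prod fun n => ?_
  have : (fun p : (Fin n → α) × α => p.2 :: List.ofFn p.1)
      = fun p => List.ofFn (Fin.cons p.2 p.1 : Fin (n + 1) → α) := by
    ext1 p; simp [List.ofFn_succ]
  rw [this]
  refine (measurable_ofFn (n + 1)).comp (measurable_pi_lambda _ fun k => ?_)
  refine Fin.cases ?_ (fun k => ?_) k
  · simpa using measurable_snd
  · simp only [Fin.cons_succ]
    exact (measurable_pi_apply k).comp measurable_fst

lemma measurable_concat [Nonempty α] : Measurable (fun p : List α × α => p.1 ++ [p.2]) := by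
  refine measurable_from_list_prod fun n => ?_
  have : (fun p : (Fin n → α) × α => List.ofFn p.1 ++ [p.2])
      = fun p => List.ofFn (Fin.snoc p.1 p.2 : Fin (n + 1) → α) := by
    ext1 p; rw [List.ofFn_succ_last]; simp
  rw [this]
  refine (measurable_ofFn (n + 1)).comp (measurable_pi_lambda _ fun k => ?_)
  refine Fin.lastCases ?_ (fun k => ?_) k
  · simpa using measurable_snd
  · simp only [Fin.snoc_castSucc]
    exact (measurable_pi_apply k).comp measurable_fst

lemma measurable_tail : Measurable (List.tail : List α → List α) :=
  measurable_from_list fun n => by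
    cases n with
    | zero => simp
    | succ n =>
      simp only [List.ofFn_succ, List.tail_cons]
      exact (measurable_ofFn n).comp (measurable_pi_lambda _ fun k => measurable_pi_apply _)

end ListMeasurability

/-! ### Histories of a marked point sequence -/

section MarkedPoints

variable {M : Type*}

/-- The time of the latest point of a list of marked points, latest first. -/
def lastTime : List (ℝ × M) → ℝ
  | [] => 0
  | p :: _ => p.1

@[simp] lemma lastTime_cons (p : ℝ × M) (L : List (ℝ × M)) : lastTime (p :: L) = p.1 := rfl

/-- The first `n` points, latest first, of the marked point process with gaps `(z m).1` and marks
`(z m).2`. -/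
def hist (z : ℕ → ℝ × M) : ℕ → List (ℝ × M)
  | 0 => []
  | n + 1 => (lastTime (hist z n) + (z n).1, (z n).2) :: hist z n

/-- The number of points in `[0, s]`. -/
noncomputable def pointCount (z : ℕ → ℝ × M) (s : ℝ) : ℕ :=
  {n : ℕ | lastTime (hist z (n + 1)) ≤ s}.ncard

lemma hist_congr {z z' : ℕ → ℝ × M} {n : ℕ} (h : ∀ m < n, z m = z' m) :
    hist z n = hist z' n := by
  induction n with
  | zero => rfl
  | succ n ih => simp only [hist, ih fun m hm => h m (by omega), h n (by omega)]

lemma lastTime_hist_succ (z : ℕ → ℝ × M) (n : ℕ) :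
    lastTime (hist z (n + 1)) = lastTime (hist z n) + (z n).1 := rfl

lemma lastTime_hist (z : ℕ → ℝ × M) (n : ℕ) :
    lastTime (hist z n) = ∑ m ∈ Finset.range n, (z m).1 := by
  induction n with
  | zero => rfl
  | succ n ih => rw [lastTime_hist_succ, ih, Finset.sum_range_succ]

lemma monotone_lastTime_hist {z : ℕ → ℝ × M} (hz : ∀ n, 0 ≤ (z n).1) :
    Monotone fun n => lastTime (hist z n) :=
  monotone_nat_of_le_succ fun n => by
    simp only [lastTime_hist_succ]; linarith [hz n]

/-- A gap longer than `s` forces only finitely many points in `[0, s]`. This excludes the infinite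
case, in which `Set.ncard` returns the junk value `0`. -/
lemma pointCount_eq_iff {z : ℕ → ℝ × M} (hz : ∀ n, 0 ≤ (z n).1) {s : ℝ}
    (hs : 0 ≤ s) (hlarge : ∃ n, s < (z n).1) (n : ℕ) :
    pointCount z s = n ↔ lastTime (hist z n) ≤ s ∧ s < lastTime (hist z (n + 1)) := by
  have hmono := monotone_lastTime_hist hz
  have h0 : ∀ n, 0 ≤ lastTime (hist z n) := fun n => hmono (Nat.zero_le n)
  have hex : ∃ n, s < lastTime (hist z (n + 1)) := by
    obtain ⟨n, hn⟩ := hlarge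
    exact ⟨n, by rw [lastTime_hist_succ]; linarith [h0 n]⟩
  classical
  have hchar : ∀ n, (lastTime (hist z n) ≤ s ∧ s < lastTime (hist z (n + 1))) →
      pointCount z s = n := by
    rintro n ⟨h1, h2⟩
    have : {m : ℕ | lastTime (hist z (m + 1)) ≤ s} = ((Finset.range n : Finset ℕ) : Set ℕ) := by
      ext m
      simp only [Set.mem_ofPred_eq, Finset.coe_range, Set.mem_Iio]
      constructor
      · intro h
        by_contra hm
        have : lastTime (hist z (n + 1)) ≤ lastTime (hist z (m + 1)) := hmono (by omega)
        linarith
      · intro h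
        have : lastTime (hist z (m + 1)) ≤ lastTime (hist z n) := hmono (by omega)
        linarith
    rw [pointCount, this, Set.ncard_coe_finset, Finset.card_range]
  refine ⟨?_, hchar n⟩
  rintro rfl
  have hk : lastTime (hist z (Nat.find hex)) ≤ s ∧ s < lastTime (hist z (Nat.find hex + 1)) := by
    refine ⟨?_, Nat.find_spec hex⟩
    rcases h : Nat.find hex with _ | k
    · exact hs
    · have := Nat.find_min hex (m := k) (by omega)
      simpa using this
  rw [hchar _ hk]
  exact hk

variable [MeasurableSpace M]

lemma measurable_lastTime [Nonempty M] : Measurable (lastTime : List (ℝ × M) → ℝ) := by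
  have : (lastTime : List (ℝ × M) → ℝ) = fun L => (L.getD 0 (0, Classical.arbitrary M)).1 := by
    ext L; cases L <;> simp [lastTime]
  rw [this]
  exact measurable_fst.comp (measurable_list_getD _ 0)

lemma measurable_hist [Nonempty M] (n : ℕ) :
    Measurable (fun z : ℕ → ℝ × M => hist z n) := by
  induction n with
  | zero => exact measurable_const
  | succ n ih =>
    simp only [hist]
    have h : Measurable fun z : ℕ → ℝ × M => z n := measurable_pi_apply n
    exact measurable_cons.comp (ih.prodMk
      (((measurable_lastTime.comp ih).add h.fst).prodMk h.snd))

end MarkedPoints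

end JSQ

/-! ### Marked Poisson processes: integrating out the latest point -/

namespace JSQ

open Set
open scoped ENNReal

lemma lintegral_expMeasure {r : ℝ} {h : ℝ → ℝ≥0∞} (hh : Measurable h) :
    ∫⁻ x, h x ∂(expMeasure r) =
      ∫⁻ x in Ici 0, ENNReal.ofReal (r * Real.exp (-(r * x))) * h x := by
  have h1 : expMeasure r = volume.withDensity (exponentialPDF r) := rfl
  have h2 : Measurable (exponentialPDF r) := (measurable_exponentialPDFReal r).ennreal_ofReal
  rw [h1, lintegral_withDensity_eq_lintegral_mul _ h2 hh,
    ← lintegral_indicator measurableSet_Ici]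
  refine lintegral_congr fun x => ?_
  simp only [Pi.mul_apply, indicator, mem_Ici, exponentialPDF_eq]
  split_ifs <;> simp

lemma lintegral_exp_tail {r : ℝ} (hr : 0 < r) (x : ℝ) :
    ∫⁻ y in Ioi x, ENNReal.ofReal (r * Real.exp (-(r * y))) =
      ENNReal.ofReal (Real.exp (-(r * x))) := by
  have hint := (integrableOn_exp_mul_Ioi (a := -r) (by linarith) x).const_mul r
  have hval := integral_exp_mul_Ioi (a := -r) (by linarith) x
  simp only [neg_mul] at hint hval
  rw [← ofReal_integral_eq_lintegral_ofReal hint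
    (Filter.Eventually.of_forall fun y => by positivity), integral_const_mul, hval]
  congr 1
  field_simp

variable {M 𝒴 Ω : Type*} [MeasurableSpace M] [MeasurableSpace 𝒴] [MeasurableSpace Ω]

/-- `Z` consists of the independent exponential gaps of rate `r` and the independent marks of law
`ρ` of a marked Poisson process, and `Y` is independent of it. -/
structure IsMarkedPoisson (r : ℝ) (ρ : Measure M) (P : Measure Ω) (Z : ℕ → Ω → ℝ × M)
    (Y : Ω → 𝒴) : Prop where
  measurable_points : ∀ n, Measurable (Z n)
  measurable_param : Measurable Y
  law : ∀ n, P.map (Z n) = (expMeasure r).prod ρ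
  indep : iIndepFun Z P
  indep_param : IndepFun Y (fun ω n => Z n ω) P

/-- The history of the point process up to time `s`. -/
noncomputable def histUpTo (Z : ℕ → Ω → ℝ × M) (s : ℝ) (ω : Ω) : List (ℝ × M) :=
  hist (fun n => Z n ω) (pointCount (fun n => Z n ω) s)

namespace IsMarkedPoisson

variable {r : ℝ} {ρ : Measure M} {P : Measure Ω} {Z : ℕ → Ω → ℝ × M} {Y : Ω → 𝒴}

lemma measurable_hist_comp [Nonempty M] (h : IsMarkedPoisson r ρ P Z Y) (n : ℕ) :
    Measurable (fun ω => hist (fun m => Z m ω) n) :=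
  (measurable_hist n).comp (measurable_pi_lambda _ h.measurable_points)

lemma indepFun_hist [Nonempty M] [IsProbabilityMeasure P] (h : IsMarkedPoisson r ρ P Z Y) (n : ℕ) :
    IndepFun (fun ω => hist (fun m => Z m ω) n) (Z n) P := by
  classical
  have h1 := h.indep.indepFun_finset (Finset.range n) {n} (by simp) h.measurable_points
  -- Only the first `n` points enter `hist _ n`, so the value filled in at the remaining indices is
  -- irrelevant.
  let a : ℝ × M := Classical.arbitrary _
  let φ : (Finset.range n → ℝ × M) → List (ℝ × M) := fun v =>
    hist (fun m => if hm : m ∈ Finset.range n then v ⟨m, hm⟩ else a) n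
  have hφ : Measurable φ := by
    refine (measurable_hist n).comp (measurable_pi_lambda _ fun m => ?_)
    by_cases hm : m ∈ Finset.range n
    · simp only [hm, dite_true]; exact measurable_pi_apply _
    · simp only [hm, dite_false]; exact measurable_const
  have h2 := h1.comp hφ (measurable_pi_apply (⟨n, by simp⟩ : ({n} : Finset ℕ)))
  have h3 : (fun ω => hist (fun m => Z m ω) n) = φ ∘ fun ω (i : Finset.range n) => Z i ω := by
    ext1 ω
    exact hist_congr fun m hm => by simp [hm]
  rw [h3]
  exact h2

/-- The parameter is independent of all points and the next point is independent of the earlier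
ones, so history, parameter and next point are mutually independent. Regrouping the three factors is
Tonelli's theorem. -/
lemma map_joint [Nonempty M] [IsProbabilityMeasure P] [IsProbabilityMeasure ρ] (hr : 0 < r)
    (h : IsMarkedPoisson r ρ P Z Y) (n : ℕ) :
    P.map (fun ω => ((hist (fun m => Z m ω) n, Y ω), Z n ω)) =
      (P.map fun ω => (hist (fun m => Z m ω) n, Y ω)).prod ((expMeasure r).prod ρ) := by
  have hH := h.measurable_hist_comp n
  have hZ := h.measurable_points n
  have hY := h.measurable_param
  have hm : Measurable fun z : ℕ → ℝ × M => (hist z n, z n) :=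
    (measurable_hist n).prodMk (measurable_pi_apply n)
  have h1 : IndepFun (fun ω => (hist (fun m => Z m ω) n, Z n ω)) Y P :=
    (h.indep_param.comp measurable_id hm).symm
  have h2 : IndepFun (fun ω => hist (fun m => Z m ω) n) Y P := h1.comp measurable_fst measurable_id
  have e1 := (indepFun_iff_map_prod_eq_prod_map_map (hH.prodMk hZ).aemeasurable
    hY.aemeasurable).1 h1
  have e2 := (indepFun_iff_map_prod_eq_prod_map_map hH.aemeasurable hZ.aemeasurable).1
    (h.indepFun_hist n)
  have e3 := (indepFun_iff_map_prod_eq_prod_map_map hH.aemeasurable hY.aemeasurable).1 h2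
  have := isProbabilityMeasure_expMeasure hr
  have i1 : IsProbabilityMeasure (P.map fun ω => hist (fun m => Z m ω) n) :=
    Measure.isProbabilityMeasure_map hH.aemeasurable
  have i2 : IsProbabilityMeasure (P.map Y) := Measure.isProbabilityMeasure_map hY.aemeasurable
  have hlaw := h.law n
  rw [e2, hlaw] at e1
  rw [e3]
  symm
  refine Measure.ext_of_lintegral _ fun f hf => ?_
  let g : ((List (ℝ × M) × (ℝ × M)) × 𝒴) → ℝ≥0∞ := fun q => f ((q.1.1, q.2), q.1.2)
  have hg : Measurable g := hf.comp
    ((measurable_fst.fst.prodMk measurable_snd).prodMk measurable_fst.snd)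
  have e4 : ∫⁻ q, f q ∂(P.map (fun ω => ((hist (fun m => Z m ω) n, Y ω), Z n ω)))
      = ∫⁻ q, g q ∂(P.map (fun ω => ((hist (fun m => Z m ω) n, Z n ω), Y ω))) := by
    rw [lintegral_map hf ((hH.prodMk hY).prodMk hZ), lintegral_map hg ((hH.prodMk hZ).prodMk hY)]
  rw [e4, e1, lintegral_prod _ hf.aemeasurable,
    lintegral_prod _ (hf.lintegral_prod_right').aemeasurable,
    lintegral_prod _ hg.aemeasurable, lintegral_prod _ (hg.lintegral_prod_right').aemeasurable]
  refine lintegral_congr fun L => ?_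
  rw [lintegral_lintegral_swap]
  exact (hf.comp ((measurable_const.prodMk measurable_fst).prodMk measurable_snd)).aemeasurable

/-- Integrating out the latest of the first `n + 1` points. -/
lemma lintegral_hist_succ [Nonempty M] [IsProbabilityMeasure P] [IsProbabilityMeasure ρ]
    (hr : 0 < r) (h : IsMarkedPoisson r ρ P Z Y) (n : ℕ) {G : List (ℝ × M) × 𝒴 → ℝ≥0∞}
    (hG : Measurable G) :
    ∫⁻ ω, G (hist (fun m => Z m ω) (n + 1), Y ω) ∂P =
      ∫⁻ ω, (∫⁻ τ in Ici (lastTime (hist (fun m => Z m ω) n)),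
        ENNReal.ofReal (r * Real.exp (-(r * (τ - lastTime (hist (fun m => Z m ω) n))))) *
          ∫⁻ m, G ((τ, m) :: hist (fun m => Z m ω) n, Y ω) ∂ρ) ∂P := by
  have := isProbabilityMeasure_expMeasure hr
  have hH := h.measurable_hist_comp n
  have hZ := h.measurable_points n
  have hY := h.measurable_param
  let Φ : (List (ℝ × M) × 𝒴) × (ℝ × M) → ℝ≥0∞ := fun q =>
    G ((lastTime q.1.1 + q.2.1, q.2.2) :: q.1.1, q.1.2)
  have hΦ : Measurable Φ := by
    refine hG.comp (Measurable.prodMk ?_ measurable_fst.snd)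
    exact measurable_cons.comp (measurable_fst.fst.prodMk
      (((measurable_lastTime.comp measurable_fst.fst).add measurable_snd.fst).prodMk
        measurable_snd.snd))
  have e1 : ∫⁻ ω, G (hist (fun m => Z m ω) (n + 1), Y ω) ∂P =
      ∫⁻ q, Φ q ∂(P.map (fun ω => ((hist (fun m => Z m ω) n, Y ω), Z n ω))) := by
    rw [lintegral_map hΦ ((hH.prodMk hY).prodMk hZ)]
    rfl
  rw [e1, h.map_joint hr n, lintegral_prod _ hΦ.aemeasurable,
    lintegral_map hΦ.lintegral_prod_right' (hH.prodMk hY)]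
  refine lintegral_congr fun ω => ?_
  set H := hist (fun m => Z m ω) n
  have hΦ' : Measurable fun x : ℝ × M => Φ ((H, Y ω), x) :=
    hΦ.comp (measurable_const.prodMk measurable_id)
  -- The integration variable changes from the gap to the absolute time `τ` of the new point, by
  -- translation invariance of Lebesgue measure.
  rw [lintegral_prod _ hΦ'.aemeasurable, lintegral_expMeasure hΦ'.lintegral_prod_right',
    ← lintegral_indicator measurableSet_Ici, ← lintegral_indicator measurableSet_Ici,
    ← lintegral_sub_right_eq_self _ (lastTime H)]
  refine lintegral_congr fun τ => ?_
  simp [indicator, Φ]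

end IsMarkedPoisson

end JSQ

/-! ### Decomposition by the number of points in a time interval -/

namespace JSQ

open Set
open scoped ENNReal

variable {M 𝒴 Ω : Type*} [MeasurableSpace M] [MeasurableSpace 𝒴] [MeasurableSpace Ω]

/-- The probability that a Poisson process of rate `r` has no point between `T` and `s`. -/
noncomputable def gapWeight (r s T : ℝ) : ℝ≥0∞ :=
  if T ≤ s then ENNReal.ofReal (Real.exp (-(r * (s - T)))) else 0

lemma measurable_gapWeight (r : ℝ) : Measurable fun p : ℝ × ℝ => gapWeight r p.1 p.2 := by
  unfold gapWeight
  exact Measurable.ite (measurableSet_le measurable_snd measurable_fst) (by fun_prop)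
    measurable_const

/-- The contribution of the configurations with exactly `n` points to the expectation of `F`,
evaluated at the history of the process up to time `s`. -/
noncomputable def pointTerm (r : ℝ) (P : Measure Ω) (Z : ℕ → Ω → ℝ × M) (Y : Ω → 𝒴) (n : ℕ) (s : ℝ)
    (F : List (ℝ × M) × 𝒴 → ℝ≥0∞) : ℝ≥0∞ :=
  ∫⁻ ω, gapWeight r s (lastTime (hist (fun m => Z m ω) n)) *
    F (hist (fun m => Z m ω) n, Y ω) ∂P

/-- The function of the past that results from `F` if `p` is the latest point. -/
def addPoint {δ : Type*} (F : List (ℝ × M) × 𝒴 → δ) (p : ℝ × M) : List (ℝ × M) × 𝒴 → δ :=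
  fun q => F (p :: q.1, q.2)

lemma measurable_addPoint [Nonempty M] {δ : Type*} [MeasurableSpace δ]
    {F : List (ℝ × M) × 𝒴 → δ} (hF : Measurable F) :
    Measurable fun q : (ℝ × M) × (List (ℝ × M) × 𝒴) => addPoint F q.1 q.2 :=
  hF.comp ((measurable_cons.comp (measurable_snd.fst.prodMk measurable_fst)).prodMk
    measurable_snd.snd)

namespace IsMarkedPoisson

variable {r : ℝ} {ρ : Measure M} {P : Measure Ω} {Z : ℕ → Ω → ℝ × M} {Y : Ω → 𝒴}

/-- The event of having exactly `n` points up to `s` concerns the point after them as well. It is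
therefore read off from the first `n + 1` points, whose tail is the history, and the latest of these
is integrated out, leaving an exponential tail. -/
lemma lintegral_gap [Nonempty M] [IsProbabilityMeasure P] [IsProbabilityMeasure ρ]
    (hr : 0 < r) (h : IsMarkedPoisson r ρ P Z Y) (n : ℕ) (s : ℝ)
    {F : List (ℝ × M) × 𝒴 → ℝ≥0∞} (hF : Measurable F) :
    ∫⁻ ω, (if lastTime (hist (fun m => Z m ω) n) ≤ s ∧
        s < lastTime (hist (fun m => Z m ω) (n + 1))
      then F (hist (fun m => Z m ω) n, Y ω) else 0) ∂P = pointTerm r P Z Y n s F := by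
  let G : List (ℝ × M) × 𝒴 → ℝ≥0∞ := fun q =>
    if lastTime q.1.tail ≤ s ∧ s < lastTime q.1 then F (q.1.tail, q.2) else 0
  have ht : Measurable fun q : List (ℝ × M) × 𝒴 => q.1.tail := measurable_tail.comp measurable_fst
  have hG : Measurable G := by
    refine Measurable.ite ?_ (hF.comp (ht.prodMk measurable_snd)) measurable_const
    exact (measurableSet_le (measurable_lastTime.comp ht) measurable_const).inter
      (measurableSet_lt measurable_const (measurable_lastTime.comp measurable_fst))
  have e := h.lintegral_hist_succ hr n hG
  have e' : ∀ ω, G (hist (fun m => Z m ω) (n + 1), Y ω) =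
      (if lastTime (hist (fun m => Z m ω) n) ≤ s ∧ s < lastTime (hist (fun m => Z m ω) (n + 1))
      then F (hist (fun m => Z m ω) n, Y ω) else 0) := fun ω => rfl
  simp only [e'] at e
  rw [e, pointTerm]
  refine lintegral_congr fun ω => ?_
  set H := hist (fun m => Z m ω) n
  have e0 : ∀ τ m, G ((τ, m) :: H, Y ω) = if lastTime H ≤ s ∧ s < τ then F (H, Y ω) else 0 :=
    fun _ _ => rfl
  simp only [e0, lintegral_const, measure_univ, mul_one]
  unfold gapWeight
  by_cases hT : lastTime H ≤ s
  · simp only [hT, true_and, if_true]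
    rw [← lintegral_indicator measurableSet_Ici]
    have e1 : ∀ τ, (Ici (lastTime H)).indicator (fun τ =>
          ENNReal.ofReal (r * Real.exp (-(r * (τ - lastTime H)))) *
            if s < τ then F (H, Y ω) else 0) τ =
        (Ioi s).indicator (fun τ => ENNReal.ofReal (r * Real.exp (-(r * τ))) *
          (ENNReal.ofReal (Real.exp (r * lastTime H)) * F (H, Y ω))) τ := by
      intro τ
      by_cases h1 : s < τ
      · have h2 : lastTime H ≤ τ := by linarith
        simp only [indicator, mem_Ici, mem_Ioi, h1, h2, if_true]
        rw [← mul_assoc, ← ENNReal.ofReal_mul (by positivity), mul_assoc, ← Real.exp_add]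
        ring_nf
      · simp [indicator, h1]
    simp only [e1]
    rw [lintegral_indicator measurableSet_Ioi, lintegral_mul_const _ (by fun_prop),
      lintegral_exp_tail hr, ← mul_assoc, ← ENNReal.ofReal_mul (by positivity), ← Real.exp_add]
    ring_nf
  · simp [hT]

lemma ae_gap_nonneg [IsProbabilityMeasure P] [IsProbabilityMeasure ρ]
    (hr : 0 < r) (h : IsMarkedPoisson r ρ P Z Y) : ∀ᵐ ω ∂P, ∀ n, 0 ≤ (Z n ω).1 := by
  have := isProbabilityMeasure_expMeasure hr
  refine ae_all_iff.2 fun n => ?_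
  have h1 : ∀ᵐ x ∂(P.map (Z n)), 0 ≤ x.1 := by
    rw [h.law n]
    have h2 : ∀ᵐ x ∂(expMeasure r), 0 ≤ x := by
      rw [ae_iff]
      have : expMeasure r {x | ¬ 0 ≤ x} =
          ∫⁻ x, (Iio (0 : ℝ)).indicator 1 x ∂(expMeasure r) := by
        rw [lintegral_indicator_one measurableSet_Iio]
        congr 1
        ext x; simp
      rw [this, lintegral_expMeasure (measurable_one.indicator measurableSet_Iio),
        ← lintegral_indicator measurableSet_Ici]
      simp only [indicator]
      rw [lintegral_eq_zero_iff' (by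
        refine Measurable.aemeasurable (Measurable.ite measurableSet_Ici ?_ measurable_const)
        exact Measurable.mul (by fun_prop)
          (Measurable.ite measurableSet_Iio measurable_const measurable_const))]
      refine Filter.Eventually.of_forall fun x => ?_
      by_cases hx : 0 ≤ x <;> simp [hx]
    exact (Measure.quasiMeasurePreserving_fst (μ := expMeasure r) (ν := ρ)).ae h2
  exact ae_of_ae_map (h.measurable_points n).aemeasurable h1

/-- Independence gives probability `q ^ n` that the first `n` gaps are all at most `s`, and `q < 1`.
This is what excludes explosion. -/
lemma ae_exists_gap_gt [IsProbabilityMeasure P] [IsProbabilityMeasure ρ]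
    (hr : 0 < r) (h : IsMarkedPoisson r ρ P Z Y) (s : ℝ) : ∀ᵐ ω ∂P, ∃ n, s < (Z n ω).1 := by
  have := isProbabilityMeasure_expMeasure hr
  let A : Set (ℝ × M) := {x | x.1 ≤ s}
  have hA : MeasurableSet A := measurableSet_le measurable_fst measurable_const
  let q := (expMeasure r) (Iic s)
  have hq : ∀ n, P (Z n ⁻¹' A) = q := fun n => by
    rw [← Measure.map_apply (h.measurable_points n) hA, h.law n]
    have : A = Iic s ×ˢ univ := by ext x; simp [A]
    rw [this, Measure.prod_prod]; simp [q]
  have hq1 : q < 1 := by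
    refine lt_of_le_of_ne prob_le_one fun hq => ?_
    have h1 : ∫⁻ x, (Ioi s).indicator 1 x ∂(expMeasure r) = 0 := by
      rw [lintegral_indicator_one measurableSet_Ioi, ← compl_Iic]
      exact (prob_compl_eq_zero_iff measurableSet_Iic).2 hq
    rw [lintegral_expMeasure (measurable_one.indicator measurableSet_Ioi)] at h1
    have h2 : ∫⁻ y in Ioi (max s 0), ENNReal.ofReal (r * Real.exp (-(r * y))) ≤ 0 := by
      rw [← h1, ← lintegral_indicator measurableSet_Ici, ← lintegral_indicator measurableSet_Ioi]
      refine lintegral_mono fun y => ?_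
      by_cases hy : max s 0 < y
      · have := max_lt_iff.1 hy
        simp [indicator, hy, this.1, this.2.le]
      · simp [indicator, hy]
    rw [lintegral_exp_tail hr, nonpos_iff_eq_zero, ENNReal.ofReal_eq_zero] at h2
    exact absurd (Real.exp_pos _) (not_lt.2 h2)
  rw [ae_iff]
  have hle : ∀ n : ℕ, P {ω | ¬ ∃ n, s < (Z n ω).1} ≤ q ^ n := by
    intro n
    have := h.indep.measure_inter_preimage_eq_mul (Finset.range n) (sets := fun _ => A)
      (fun _ _ => hA)
    rw [Finset.prod_congr rfl fun n _ => hq n, Finset.prod_const, Finset.card_range] at this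
    rw [← this]
    refine measure_mono fun ω hω => ?_
    simp only [mem_iInter, mem_preimage, A]
    intro m _
    by_contra hm
    exact hω ⟨m, not_le.1 hm⟩
  exact le_antisymm (ge_of_tendsto' (ENNReal.tendsto_pow_atTop_nhds_zero_of_lt_one hq1) hle)
    (zero_le)

lemma ae_sum_indicator [IsProbabilityMeasure P] [IsProbabilityMeasure ρ]
    (hr : 0 < r) (h : IsMarkedPoisson r ρ P Z Y) {s : ℝ} (hs : 0 ≤ s)
    (F : List (ℝ × M) × 𝒴 → ℝ≥0∞) :
    ∀ᵐ ω ∂P, F (histUpTo Z s ω, Y ω) = ∑' n,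
      (if lastTime (hist (fun m => Z m ω) n) ≤ s ∧
        s < lastTime (hist (fun m => Z m ω) (n + 1))
      then F (hist (fun m => Z m ω) n, Y ω) else 0) := by
  filter_upwards [h.ae_gap_nonneg hr, h.ae_exists_gap_gt hr s] with ω h1 h2
  have key := pointCount_eq_iff h1 hs h2
  rw [tsum_eq_single (pointCount (fun m => Z m ω) s), if_pos ((key _).1 rfl), histUpTo]
  intro n hn
  rw [if_neg fun hh => hn ((key n).2 hh).symm]

lemma lintegral_histUpTo [Nonempty M] [IsProbabilityMeasure P] [IsProbabilityMeasure ρ]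
    (hr : 0 < r) (h : IsMarkedPoisson r ρ P Z Y) {s : ℝ} (hs : 0 ≤ s)
    {F : List (ℝ × M) × 𝒴 → ℝ≥0∞} (hF : Measurable F) :
    ∫⁻ ω, F (histUpTo Z s ω, Y ω) ∂P = ∑' n, pointTerm r P Z Y n s F := by
  rw [lintegral_congr_ae (h.ae_sum_indicator hr hs F), lintegral_tsum]
  · exact tsum_congr fun n => h.lintegral_gap hr n s hF
  · intro n
    have h1 := measurable_lastTime.comp (h.measurable_hist_comp n)
    have h2 := measurable_lastTime.comp (h.measurable_hist_comp (n + 1))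
    exact (Measurable.ite ((measurableSet_le h1 measurable_const).inter
      (measurableSet_lt measurable_const h2))
      (hF.comp ((h.measurable_hist_comp n).prodMk h.measurable_param))
      measurable_const).aemeasurable

omit [MeasurableSpace M] [MeasurableSpace 𝒴] in
lemma pointTerm_zero {s : ℝ} (hs : 0 ≤ s)
    (F : List (ℝ × M) × 𝒴 → ℝ≥0∞) :
    pointTerm r P Z Y 0 s F = ENNReal.ofReal (Real.exp (-(r * s))) * ∫⁻ ω, F ([], Y ω) ∂P := by
  simp only [pointTerm, hist, lastTime, gapWeight, hs, if_true, sub_zero]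
  rw [lintegral_const_mul' _ _ ENNReal.ofReal_ne_top]

lemma measurable_pointTerm [Nonempty M] [IsProbabilityMeasure P]
    (h : IsMarkedPoisson r ρ P Z Y) (n : ℕ)
    {F : List (ℝ × M) × 𝒴 → ℝ≥0∞} (hF : Measurable F) :
    Measurable fun p : ℝ × M => pointTerm r P Z Y n p.1 (addPoint F p) := by
  unfold pointTerm
  have hH := h.measurable_hist_comp n
  have hY := h.measurable_param
  refine Measurable.lintegral_prod_right' (f := fun q : (ℝ × M) × Ω =>
    gapWeight r q.1.1 (lastTime (hist (fun m => Z m q.2) n)) *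
    addPoint F q.1 (hist (fun m => Z m q.2) n, Y q.2)) ?_
  refine Measurable.mul ?_ ?_
  · exact (measurable_gapWeight r).comp
      (measurable_fst.fst.prodMk (measurable_lastTime.comp (hH.comp measurable_snd)))
  · exact (measurable_addPoint hF).comp
      (measurable_fst.prodMk ((hH.prodMk hY).comp measurable_snd))

/-- Let `T` be the time of point `n` and `τ` that of the next one. The density `r exp (-r (τ - T))`
of the latter times the weight `exp (-r (s - τ))` of no further point can be read in the other
order: `r exp (-r (s - τ))` times the weight of no point in `[T, τ]`. The second factor belongs to
the `n`-point term with horizon `τ`, so the recursion closes. Almost surely `0 ≤ T`, whence the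
domain `Icc 0 s`. -/
lemma pointTerm_succ [Nonempty M] [IsProbabilityMeasure P] [IsProbabilityMeasure ρ]
    (hr : 0 < r) (h : IsMarkedPoisson r ρ P Z Y) (n : ℕ) (s : ℝ)
    {F : List (ℝ × M) × 𝒴 → ℝ≥0∞} (hF : Measurable F) :
    pointTerm r P Z Y (n + 1) s F = ∫⁻ τ in Icc 0 s, ENNReal.ofReal (r * Real.exp (-(r * (s - τ)))) *
      ∫⁻ m, pointTerm r P Z Y n τ (addPoint F (τ, m)) ∂ρ := by
  have hH := h.measurable_hist_comp n
  have hY := h.measurable_param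
  let G : List (ℝ × M) × 𝒴 → ℝ≥0∞ := fun q => gapWeight r s (lastTime q.1) * F q
  have hG : Measurable G := ((measurable_gapWeight r).comp
    (measurable_const.prodMk (measurable_lastTime.comp measurable_fst))).mul hF
  let Φ : (Ω × ℝ) × M → ℝ≥0∞ := fun q =>
    gapWeight r q.1.2 (lastTime (hist (fun m => Z m q.1.1) n)) *
      addPoint F (q.1.2, q.2) (hist (fun m => Z m q.1.1) n, Y q.1.1)
  have hΦ : Measurable Φ := by
    refine Measurable.mul ?_ ?_
    · exact (measurable_gapWeight r).comp
        (measurable_fst.snd.prodMk (measurable_lastTime.comp (hH.comp measurable_fst.fst)))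
    · exact (measurable_addPoint hF).comp ((measurable_fst.snd.prodMk measurable_snd).prodMk
        ((hH.prodMk hY).comp measurable_fst.fst))
  have e0 : pointTerm r P Z Y (n + 1) s F =
      ∫⁻ ω, G (hist (fun m => Z m ω) (n + 1), Y ω) ∂P := rfl
  have hnonneg : ∀ᵐ ω ∂P, 0 ≤ lastTime (hist (fun m => Z m ω) n) := by
    filter_upwards [h.ae_gap_nonneg hr] with ω hω
    exact monotone_lastTime_hist hω (Nat.zero_le n)
  have e1 : ∀ᵐ ω ∂P, (∫⁻ τ in Ici (lastTime (hist (fun m => Z m ω) n)),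
        ENNReal.ofReal (r * Real.exp (-(r * (τ - lastTime (hist (fun m => Z m ω) n))))) *
          ∫⁻ m, G ((τ, m) :: hist (fun m => Z m ω) n, Y ω) ∂ρ) =
      ∫⁻ τ in Icc 0 s, ENNReal.ofReal (r * Real.exp (-(r * (s - τ)))) *
        ∫⁻ m, Φ ((ω, τ), m) ∂ρ := by
    filter_upwards [hnonneg] with ω hω
    rw [← lintegral_indicator measurableSet_Ici, ← lintegral_indicator measurableSet_Icc]
    refine lintegral_congr fun τ => ?_
    simp only [G, Φ, addPoint, lastTime_cons]
    set H := hist (fun m => Z m ω) n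
    have hF1 : Measurable fun m => F ((τ, m) :: H, Y ω) :=
      (measurable_addPoint hF).comp (Measurable.prodMk
        (f := fun m : M => (τ, m)) (g := fun _ => (H, Y ω))
        (measurable_const.prodMk measurable_id) measurable_const)
    simp only [indicator, mem_Ici, mem_Icc]
    rw [lintegral_const_mul _ hF1, lintegral_const_mul _ hF1]
    simp only [gapWeight]
    by_cases h1 : lastTime H ≤ τ
    · have h0 : 0 ≤ τ := by linarith
      by_cases h2 : τ ≤ s
      · simp only [h1, h2, h0, and_self, if_true]
        rw [← mul_assoc, ← mul_assoc, ← ENNReal.ofReal_mul (by positivity),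
          ← ENNReal.ofReal_mul (by positivity), mul_assoc r, mul_assoc r, mul_comm (Real.exp _)]
      · simp [h2]
    · simp [h1]
  rw [e0, h.lintegral_hist_succ hr n hG, lintegral_congr_ae e1, lintegral_lintegral_swap]
  · refine lintegral_congr fun τ => ?_
    rw [lintegral_const_mul' _ _ ENNReal.ofReal_ne_top, lintegral_lintegral_swap]
    · rfl
    · exact (hΦ.comp ((measurable_fst.prodMk measurable_const).prodMk
        measurable_snd)).aemeasurable
  · refine Measurable.aemeasurable ?_
    refine Measurable.mul (by fun_prop) ?_
    exact hΦ.lintegral_prod_right'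

end IsMarkedPoisson

end JSQ

/-! ### Expectations at a given horizon and their renewal equation -/

namespace JSQ

open Set
open scoped ENNReal

variable {M 𝒴 Ω : Type*} [MeasurableSpace M] [MeasurableSpace 𝒴] [MeasurableSpace Ω]

/-- The expectation of `f`, evaluated at the history of the point process up to time `s` and the
parameter. -/
noncomputable def evolve (r : ℝ) (P : Measure Ω) (Z : ℕ → Ω → ℝ × M) (Y : Ω → 𝒴) (s : ℝ)
    (f : List (ℝ × M) × 𝒴 → ℝ) : ℝ :=
  (∑' n, pointTerm r P Z Y n s (fun q => ENNReal.ofReal (f q))).toReal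

/-- Measurable functions with values in the unit interval. -/
structure IsUnitValued {δ : Type*} [MeasurableSpace δ] (f : δ → ℝ) : Prop where
  measurable : Measurable f
  nonneg : ∀ q, 0 ≤ f q
  le_one : ∀ q, f q ≤ 1

lemma IsUnitValued.mul {δ : Type*} [MeasurableSpace δ] {f g : δ → ℝ} (hf : IsUnitValued f)
    (hg : IsUnitValued g) : IsUnitValued (fun q => f q * g q) :=
  ⟨hf.measurable.mul hg.measurable, fun q => mul_nonneg (hf.nonneg q) (hg.nonneg q),
    fun q => mul_le_one₀ (hf.le_one q) (hg.nonneg q) (hg.le_one q)⟩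

lemma IsUnitValued.comp {δ ε : Type*} [MeasurableSpace δ] [MeasurableSpace ε] {f : δ → ℝ}
    (hf : IsUnitValued f) {φ : ε → δ} (hφ : Measurable φ) : IsUnitValued (fun q => f (φ q)) :=
  ⟨hf.measurable.comp hφ, fun _ => hf.nonneg _, fun _ => hf.le_one _⟩

lemma IsUnitValued.addPoint [Nonempty M] {f : List (ℝ × M) × 𝒴 → ℝ} (hf : IsUnitValued f)
    (p : ℝ × M) : IsUnitValued (addPoint f p) :=
  ⟨(measurable_addPoint hf.measurable).comp (measurable_const.prodMk measurable_id),
    fun _ => hf.nonneg _, fun _ => hf.le_one _⟩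

lemma integral_mem_unit {δ : Type*} [MeasurableSpace δ] {μ : Measure δ} [IsProbabilityMeasure μ]
    {f : δ → ℝ} (h0 : ∀ x, 0 ≤ f x) (h1 : ∀ x, f x ≤ 1) :
    0 ≤ ∫ x, f x ∂μ ∧ ∫ x, f x ∂μ ≤ 1 := by
  refine ⟨integral_nonneg h0, ?_⟩
  have := norm_integral_le_of_norm_le_const (μ := μ) (f := f) (C := 1)
    (Filter.Eventually.of_forall fun x => by rw [Real.norm_of_nonneg (h0 x)]; exact h1 x)
  simpa using (le_abs_self _).trans this

lemma integrable_of_unit {δ : Type*} [MeasurableSpace δ] {μ : Measure δ} [IsFiniteMeasure μ]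
    {f : δ → ℝ} (hm : AEStronglyMeasurable f μ) (h0 : ∀ x, 0 ≤ f x) (h1 : ∀ x, f x ≤ 1) :
    Integrable f μ :=
  Integrable.of_bound hm 1 (Filter.Eventually.of_forall fun x => by
    rw [Real.norm_of_nonneg (h0 x)]; exact h1 x)

namespace IsMarkedPoisson

variable {r : ℝ} {ρ : Measure M} {P : Measure Ω} {Z : ℕ → Ω → ℝ × M} {Y : Ω → 𝒴}
  [Nonempty M] [IsProbabilityMeasure P] [IsProbabilityMeasure ρ]
  (hr : 0 < r) (h : IsMarkedPoisson r ρ P Z Y)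
include hr h

lemma aestronglyMeasurable_histUpTo {s : ℝ} (hs : 0 ≤ s) {f : List (ℝ × M) × 𝒴 → ℝ}
    (hf : IsUnitValued f) :
    AEStronglyMeasurable (fun ω => f (histUpTo Z s ω, Y ω)) P := by
  have h1 := h.ae_sum_indicator hr hs (fun q => ENNReal.ofReal (f q))
  have h2 : AEMeasurable (fun ω => ENNReal.ofReal (f (histUpTo Z s ω, Y ω))) P := by
    refine (Measurable.aemeasurable ?_).congr (Filter.EventuallyEq.symm h1)
    refine Measurable.tsum fun n => ?_
    have h1 := measurable_lastTime.comp (h.measurable_hist_comp n)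
    have h2 := measurable_lastTime.comp (h.measurable_hist_comp (n + 1))
    exact Measurable.ite ((measurableSet_le h1 measurable_const).inter
      (measurableSet_lt measurable_const h2))
      (hf.measurable.comp ((h.measurable_hist_comp n).prodMk h.measurable_param)).ennreal_ofReal
      measurable_const
  have h3 := h2.ennreal_toReal
  simp only [ENNReal.toReal_ofReal (hf.nonneg _)] at h3
  exact h3.aestronglyMeasurable

lemma integrable_histUpTo {s : ℝ} (hs : 0 ≤ s) {f : List (ℝ × M) × 𝒴 → ℝ}
    (hf : IsUnitValued f) : Integrable (fun ω => f (histUpTo Z s ω, Y ω)) P :=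
  integrable_of_unit (h.aestronglyMeasurable_histUpTo hr hs hf) (fun _ => hf.nonneg _)
    (fun _ => hf.le_one _)

/-- Both forms are needed. The series is jointly measurable in the horizon and the added point,
because each term is; the integral makes the bounds by `0` and `1` evident. -/
lemma evolve_eq_integral {s : ℝ} (hs : 0 ≤ s) {f : List (ℝ × M) × 𝒴 → ℝ}
    (hf : IsUnitValued f) : evolve r P Z Y s f = ∫ ω, f (histUpTo Z s ω, Y ω) ∂P := by
  rw [evolve, ← h.lintegral_histUpTo hr hs hf.measurable.ennreal_ofReal,
    integral_eq_lintegral_of_nonneg_ae (Filter.Eventually.of_forall fun _ => hf.nonneg _)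
      (h.aestronglyMeasurable_histUpTo hr hs hf)]

lemma evolve_mem {s : ℝ} (hs : 0 ≤ s) {f : List (ℝ × M) × 𝒴 → ℝ}
    (hf : IsUnitValued f) : 0 ≤ evolve r P Z Y s f ∧ evolve r P Z Y s f ≤ 1 := by
  rw [h.evolve_eq_integral hr hs hf]
  exact integral_mem_unit (fun _ => hf.nonneg _) (fun _ => hf.le_one _)

omit hr [IsProbabilityMeasure ρ] in
lemma measurable_evolve {f : List (ℝ × M) × 𝒴 → ℝ} (hf : IsUnitValued f) :
    Measurable fun p : ℝ × M => evolve r P Z Y p.1 (addPoint f p) := by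
  unfold evolve
  exact (Measurable.tsum fun n =>
    h.measurable_pointTerm n hf.measurable.ennreal_ofReal).ennreal_toReal

omit hr [IsProbabilityMeasure ρ] in
-- Adding a point to `f` composed with `List.tail` gives back `f`, so this is a case of
-- `measurable_evolve`.
lemma measurable_evolve_left {f : List (ℝ × M) × 𝒴 → ℝ} (hf : IsUnitValued f) :
    Measurable fun s : ℝ => evolve r P Z Y s f := by
  have h1 : IsUnitValued fun q : List (ℝ × M) × 𝒴 => f (q.1.tail, q.2) :=
    hf.comp ((measurable_tail.comp measurable_fst).prodMk measurable_snd)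
  have h2 : Measurable fun s : ℝ => (s, Classical.arbitrary M) := by fun_prop
  exact (h.measurable_evolve h1).comp h2

/-- The renewal equation for expectations, by the time and mark of the latest point. -/
lemma exp_mul_evolve {s : ℝ} (hs : 0 ≤ s) {f : List (ℝ × M) × 𝒴 → ℝ} (hf : IsUnitValued f) :
    Real.exp (r * s) * evolve r P Z Y s f = (∫ ω, f ([], Y ω) ∂P) +
      ∫ τ in 0..s, r * Real.exp (r * τ) * ∫ m, evolve r P Z Y τ (addPoint f (τ, m)) ∂ρ := by
  set F : List (ℝ × M) × 𝒴 → ℝ≥0∞ := fun q => ENNReal.ofReal (f q) with hF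
  have hFm : Measurable F := hf.measurable.ennreal_ofReal
  have hmeas := h.measurable_evolve hf
  have hmem : ∀ τ, 0 ≤ τ → ∀ m, 0 ≤ evolve r P Z Y τ (addPoint f (τ, m)) ∧
      evolve r P Z Y τ (addPoint f (τ, m)) ≤ 1 := fun τ hτ m =>
    h.evolve_mem hr hτ (hf.addPoint _)
  have e1 : ∀ τ, 0 ≤ τ → ∀ m, ∑' n, pointTerm r P Z Y n τ (addPoint F (τ, m)) =
      ENNReal.ofReal (evolve r P Z Y τ (addPoint f (τ, m))) := by
    intro τ hτ m
    rw [evolve, ENNReal.ofReal_toReal]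
    · rfl
    · have h1 : IsUnitValued (addPoint f (τ, m)) := hf.addPoint _
      rw [← h.lintegral_histUpTo hr hτ h1.measurable.ennreal_ofReal]
      refine ne_top_of_le_ne_top ENNReal.one_ne_top ?_
      calc _ ≤ ∫⁻ ω, 1 ∂P := lintegral_mono fun ω => by
              rw [← ENNReal.ofReal_one]; exact ENNReal.ofReal_le_ofReal (h1.le_one _)
        _ = 1 := by simp
  have e2 : ∀ τ, 0 ≤ τ → ∫⁻ m, ∑' n, pointTerm r P Z Y n τ (addPoint F (τ, m)) ∂ρ =
      ENNReal.ofReal (∫ m, evolve r P Z Y τ (addPoint f (τ, m)) ∂ρ) := by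
    intro τ hτ
    rw [ofReal_integral_eq_lintegral_ofReal]
    · exact lintegral_congr (e1 τ hτ)
    · exact integrable_of_unit (hmeas.comp (measurable_const.prodMk
        measurable_id)).aestronglyMeasurable (fun m => (hmem τ hτ m).1) fun m => (hmem τ hτ m).2
    · exact Filter.Eventually.of_forall fun m => (hmem τ hτ m).1
  have hI : ∀ τ, 0 ≤ τ → 0 ≤ ∫ m, evolve r P Z Y τ (addPoint f (τ, m)) ∂ρ ∧
      ∫ m, evolve r P Z Y τ (addPoint f (τ, m)) ∂ρ ≤ 1 := fun τ hτ =>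
    integral_mem_unit (fun m => (hmem τ hτ m).1) fun m => (hmem τ hτ m).2
  have hIm : StronglyMeasurable fun τ => ∫ m, evolve r P Z Y τ (addPoint f (τ, m)) ∂ρ :=
    hmeas.stronglyMeasurable.integral_prod_right'
  have e3 : ∑' n, pointTerm r P Z Y n s F = ENNReal.ofReal (Real.exp (-(r * s))) *
      ∫⁻ ω, F ([], Y ω) ∂P + ENNReal.ofReal (∫ τ in Icc 0 s, r * Real.exp (-(r * (s - τ))) *
        ∫ m, evolve r P Z Y τ (addPoint f (τ, m)) ∂ρ) := by
    -- The term without points gives the initial value; every other term has a latest point, at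
    -- which the recursion `pointTerm_succ` applies.
    rw [tsum_eq_zero_add' ENNReal.summable, pointTerm_zero hs]
    congr 1
    rw [ofReal_integral_eq_lintegral_ofReal]
    · simp only [fun n => h.pointTerm_succ hr n s hFm]
      rw [← lintegral_tsum]
      · refine setLIntegral_congr_fun measurableSet_Icc fun τ hτ => ?_
        rw [ENNReal.ofReal_mul (p := r * Real.exp _) (by positivity), ← e2 τ hτ.1, lintegral_tsum, ENNReal.tsum_mul_left]
        intro n
        exact ((h.measurable_pointTerm n hFm).comp
          (measurable_const.prodMk measurable_id)).aemeasurable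
      · intro n
        refine Measurable.aemeasurable (Measurable.mul (by fun_prop) ?_)
        exact (h.measurable_pointTerm n hFm).lintegral_prod_right'
    · refine IntegrableOn.of_bound (by simp) (C := r)
        (StronglyMeasurable.mul (by fun_prop) hIm).aestronglyMeasurable ?_
      refine (ae_restrict_mem measurableSet_Icc).mono fun τ hτ => ?_
      rw [Real.norm_of_nonneg (mul_nonneg (by positivity) (hI τ hτ.1).1)]
      have h1 : Real.exp (-(r * (s - τ))) ≤ 1 := Real.exp_le_one_iff.2 (by
        have := mul_nonneg hr.le (sub_nonneg.2 hτ.2); linarith)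
      calc r * Real.exp (-(r * (s - τ))) * _ ≤ r * 1 * 1 := by
            refine mul_le_mul (by gcongr) (hI τ hτ.1).2 (hI τ hτ.1).1 (by positivity)
        _ = r := by ring
    · refine (ae_restrict_mem measurableSet_Icc).mono fun τ hτ => ?_
      exact mul_nonneg (by positivity) (hI τ hτ.1).1
  have hb : ∫⁻ ω, F ([], Y ω) ∂P = ENNReal.ofReal (∫ ω, f ([], Y ω) ∂P) := by
    have h1 : Measurable fun ω => f ([], Y ω) :=
      hf.measurable.comp (measurable_const.prodMk h.measurable_param)
    rw [ofReal_integral_eq_lintegral_ofReal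
      (integrable_of_unit h1.aestronglyMeasurable (fun _ => hf.nonneg _) fun _ => hf.le_one _)
      (Filter.Eventually.of_forall fun _ => hf.nonneg _)]
  have hb0 : 0 ≤ ∫ ω, f ([], Y ω) ∂P := integral_nonneg fun _ => hf.nonneg _
  have hc0 : 0 ≤ ∫ τ in Icc 0 s, r * Real.exp (-(r * (s - τ))) *
        ∫ m, evolve r P Z Y τ (addPoint f (τ, m)) ∂ρ :=
    setIntegral_nonneg measurableSet_Icc fun τ hτ => mul_nonneg (by positivity) (hI τ hτ.1).1
  have e4 : evolve r P Z Y s f = Real.exp (-(r * s)) * ∫ ω, f ([], Y ω) ∂P +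
      ∫ τ in Icc 0 s, r * Real.exp (-(r * (s - τ))) *
        ∫ m, evolve r P Z Y τ (addPoint f (τ, m)) ∂ρ := by
    rw [evolve, ← hF, e3, hb, ← ENNReal.ofReal_mul (by positivity), ← ENNReal.ofReal_add
      (by positivity) hc0, ENNReal.toReal_ofReal (by positivity)]
  rw [e4, mul_add, ← mul_assoc, ← Real.exp_add, add_neg_cancel, Real.exp_zero, one_mul,
    integral_Icc_eq_integral_Ioc, ← intervalIntegral.integral_of_le hs,
    ← intervalIntegral.integral_const_mul]
  congr 1
  refine intervalIntegral.integral_congr fun τ _ => ?_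
  rw [← mul_assoc]
  congr 1
  rw [mul_left_comm, ← Real.exp_add]
  ring_nf

end IsMarkedPoisson

end JSQ

/-! ### The renewal equation for covariances -/

namespace JSQ

open Set

/-- The product of two solutions of the linear equations `x' = r (a - x)` and `y' = r (b - y)`,
in integrated form. -/
lemma exp_mul_mul_eq_integral {r s x0 y0 : ℝ} (hs : 0 ≤ s) {x y a b : ℝ → ℝ}
    (ha : IntervalIntegrable (fun τ => r * Real.exp (r * τ) * a τ) volume 0 s)
    (hb : IntervalIntegrable (fun τ => r * Real.exp (r * τ) * b τ) volume 0 s)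
    (hx : ∀ τ ∈ Icc 0 s, Real.exp (r * τ) * x τ =
      x0 + ∫ σ in 0..τ, r * Real.exp (r * σ) * a σ)
    (hy : ∀ τ ∈ Icc 0 s, Real.exp (r * τ) * y τ =
      y0 + ∫ σ in 0..τ, r * Real.exp (r * σ) * b σ) :
    Real.exp (r * s) * (x s * y s) = x0 * y0 +
      ∫ τ in 0..s, r * Real.exp (r * τ) * (a τ * y τ + x τ * b τ - x τ * y τ) := by
  set A : ℝ → ℝ := fun τ => ∫ σ in 0..τ, r * Real.exp (r * σ) * a σ with hA
  set B : ℝ → ℝ := fun τ => ∫ σ in 0..τ, r * Real.exp (r * σ) * b σ with hB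
  have acA : AbsolutelyContinuousOnInterval A 0 s :=
    ha.absolutelyContinuousOnInterval_intervalIntegral (by simp)
  have acB : AbsolutelyContinuousOnInterval B 0 s :=
    hb.absolutelyContinuousOnInterval_intervalIntegral (by simp)
  have ac_const (c : ℝ) : AbsolutelyContinuousOnInterval (fun _ : ℝ => c) 0 s :=
    (LipschitzWith.const c).lipschitzOnWith.absolutelyContinuousOnInterval
  have dE (τ : ℝ) : HasDerivAt (fun τ => Real.exp (-(r * τ))) (-(r * Real.exp (-(r * τ)))) τ := by
    have h1 : HasDerivAt (fun τ : ℝ => -(r * τ)) (-r) τ := by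
      simpa using ((hasDerivAt_id τ).const_mul r).fun_neg
    convert! h1.exp using 1
    ring
  have acE : AbsolutelyContinuousOnInterval (fun τ => Real.exp (-(r * τ))) 0 s := by
    exact ContDiffOn.absolutelyContinuousOnInterval (ContDiff.contDiffOn (by fun_prop))
  have acX := (ac_const x0).fun_add acA
  -- Only one factor receives the weight `exp (-r τ)`: the quantity sought, `exp (r s) x y`, is
  -- `(exp (r s) x) * exp (-r s) * (exp (r s) y)`.
  have acY := acE.fun_mul ((ac_const y0).fun_add acB)
  have key := acX.integral_deriv_mul_eq_sub acY
  have hcong : ∫ τ in 0..s, deriv (fun τ => x0 + A τ) τ * (Real.exp (-(r * τ)) * (y0 + B τ)) +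
        (x0 + A τ) * deriv (fun τ => Real.exp (-(r * τ)) * (y0 + B τ)) τ =
      ∫ τ in 0..s, r * Real.exp (r * τ) * (a τ * y τ + x τ * b τ - x τ * y τ) := by
    -- The coefficients `a` and `b` need not be continuous, so the primitives are differentiable
    -- only almost everywhere. Absolute continuity makes this enough for integration by parts.
    refine intervalIntegral.integral_congr_ae ?_
    filter_upwards [ha.ae_hasDerivAt_integral, hb.ae_hasDerivAt_integral] with τ h1 h2 h3
    have hτ : τ ∈ uIcc 0 s := uIoc_subset_uIcc h3
    have hτ' : τ ∈ Icc 0 s := by rwa [uIcc_of_le hs] at hτ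
    have d1 : HasDerivAt (fun τ => x0 + A τ) (r * Real.exp (r * τ) * a τ) τ :=
      (h1 hτ 0 (by simp)).const_add x0
    have d2 : HasDerivAt (fun τ => y0 + B τ) (r * Real.exp (r * τ) * b τ) τ :=
      (h2 hτ 0 (by simp)).const_add y0
    rw [d1.deriv, ((dE τ).fun_mul d2).deriv, ← hx τ hτ', ← hy τ hτ']
    have e : Real.exp (-(r * τ)) * Real.exp (r * τ) = 1 := by rw [← Real.exp_add]; simp
    linear_combination (r * Real.exp (r * τ) * (a τ * y τ + x τ * b τ - x τ * y τ)) * e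
  rw [hcong] at key
  have e : Real.exp (-(r * s)) * Real.exp (r * s) = 1 := by rw [← Real.exp_add]; simp
  have hs' : s ∈ Icc 0 s := ⟨hs, le_rfl⟩
  rw [← hx s hs', ← hy s hs'] at key
  simp only [hA, hB, intervalIntegral.integral_same, mul_zero, neg_zero, Real.exp_zero] at key
  rw [key]
  linear_combination (-(Real.exp (r * s) * x s * y s)) * e

variable {M 𝒴 Ω : Type*} [MeasurableSpace M] [MeasurableSpace 𝒴] [MeasurableSpace Ω]

/-- The covariance of `f` and `g`, evaluated at the history of the point process up to time `s` and
the parameter. -/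
noncomputable def evolveCov (r : ℝ) (P : Measure Ω) (Z : ℕ → Ω → ℝ × M) (Y : Ω → 𝒴) (s : ℝ)
    (f g : List (ℝ × M) × 𝒴 → ℝ) : ℝ :=
  evolve r P Z Y s (fun q => f q * g q) - evolve r P Z Y s f * evolve r P Z Y s g

lemma abs_sub_le_one_of_mem_unit {x y : ℝ} (hx : 0 ≤ x ∧ x ≤ 1) (hy : 0 ≤ y ∧ y ≤ 1) :
    |x - y| ≤ 1 :=
  abs_le.2 ⟨by linarith [hx.1, hy.2], by linarith [hx.2, hy.1]⟩

lemma mul_mem_unit {x y : ℝ} (hx : 0 ≤ x ∧ x ≤ 1) (hy : 0 ≤ y ∧ y ≤ 1) :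
    0 ≤ x * y ∧ x * y ≤ 1 :=
  ⟨mul_nonneg hx.1 hy.1, mul_le_one₀ hx.2 hy.1 hy.2⟩

namespace IsMarkedPoisson

variable {r : ℝ} {ρ : Measure M} {P : Measure Ω} {Z : ℕ → Ω → ℝ × M} {Y : Ω → 𝒴}
  [Nonempty M] [IsProbabilityMeasure P] [IsProbabilityMeasure ρ]
  (hr : 0 < r) (h : IsMarkedPoisson r ρ P Z Y)
include hr h

lemma abs_evolveCov_le_one {s : ℝ} (hs : 0 ≤ s) {f g : List (ℝ × M) × 𝒴 → ℝ}
    (hf : IsUnitValued f) (hg : IsUnitValued g) : |evolveCov r P Z Y s f g| ≤ 1 :=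
  abs_sub_le_one_of_mem_unit (h.evolve_mem hr hs (hf.mul hg))
    (mul_mem_unit (h.evolve_mem hr hs hf) (h.evolve_mem hr hs hg))

lemma integrable_evolve_addPoint {τ : ℝ} (hτ : 0 ≤ τ) {f : List (ℝ × M) × 𝒴 → ℝ}
    (hf : IsUnitValued f) : Integrable (fun m => evolve r P Z Y τ (addPoint f (τ, m))) ρ :=
  integrable_of_unit ((h.measurable_evolve hf).comp
    (measurable_const.prodMk measurable_id)).aestronglyMeasurable
    (fun _ => (h.evolve_mem hr hτ (hf.addPoint _)).1)
    (fun _ => (h.evolve_mem hr hτ (hf.addPoint _)).2)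

lemma intervalIntegrable_exp_mul {s : ℝ} (hs : 0 ≤ s) {f : List (ℝ × M) × 𝒴 → ℝ}
    (hf : IsUnitValued f) : IntervalIntegrable
      (fun τ => r * Real.exp (r * τ) * ∫ m, evolve r P Z Y τ (addPoint f (τ, m)) ∂ρ)
      volume 0 s := by
  have hIm : StronglyMeasurable fun τ => ∫ m, evolve r P Z Y τ (addPoint f (τ, m)) ∂ρ :=
    (h.measurable_evolve hf).stronglyMeasurable.integral_prod_right'
  rw [intervalIntegrable_iff_integrableOn_Ioc_of_le hs]
  refine IntegrableOn.of_bound (by simp) (C := r * Real.exp (r * s))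
    (StronglyMeasurable.mul (by fun_prop) hIm).aestronglyMeasurable ?_
  refine (ae_restrict_mem measurableSet_Ioc).mono fun τ hτ => ?_
  have hI := integral_mem_unit (μ := ρ)
    (fun m => (h.evolve_mem hr hτ.1.le (hf.addPoint (τ, m))).1)
    (fun m => (h.evolve_mem hr hτ.1.le (hf.addPoint (τ, m))).2)
  rw [Real.norm_of_nonneg (mul_nonneg (by positivity) hI.1)]
  calc _ ≤ r * Real.exp (r * s) * 1 := by
        refine mul_le_mul ?_ hI.2 hI.1 (by positivity)
        have := hτ.2
        gcongr
    _ = r * Real.exp (r * s) := mul_one _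

/-- The renewal equation for covariances. -/
lemma exp_mul_evolveCov {s : ℝ} (hs : 0 ≤ s) {f g : List (ℝ × M) × 𝒴 → ℝ}
    (hf : IsUnitValued f) (hg : IsUnitValued g)
    (hfg : ∫ ω, f ([], Y ω) * g ([], Y ω) ∂P = (∫ ω, f ([], Y ω) ∂P) * ∫ ω, g ([], Y ω) ∂P) :
    Real.exp (r * s) * evolveCov r P Z Y s f g =
      ∫ τ in 0..s, r * Real.exp (r * τ) *
        ∫ m, (evolveCov r P Z Y τ (addPoint f (τ, m)) (addPoint g (τ, m)) +
          (evolve r P Z Y τ (addPoint f (τ, m)) - evolve r P Z Y τ f) *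
          (evolve r P Z Y τ (addPoint g (τ, m)) - evolve r P Z Y τ g)) ∂ρ := by
  have ef := fun τ (hτ : τ ∈ Icc 0 s) => h.exp_mul_evolve hr hτ.1 hf
  have eg := fun τ (hτ : τ ∈ Icc 0 s) => h.exp_mul_evolve hr hτ.1 hg
  have efg := h.exp_mul_evolve hr hs (hf.mul hg)
  have ip := exp_mul_mul_eq_integral hs (h.intervalIntegrable_exp_mul hr hs hf)
    (h.intervalIntegrable_exp_mul hr hs hg) ef eg
  have hacf := h.intervalIntegrable_exp_mul hr hs hf
  have hacg := h.intervalIntegrable_exp_mul hr hs hg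
  have hacfg := h.intervalIntegrable_exp_mul hr hs (hf.mul hg)
  have hb : ∀ {φ : List (ℝ × M) × 𝒴 → ℝ}, IsUnitValued φ →
      ∀ {G : ℝ → ℝ}, IntervalIntegrable G volume 0 s →
      IntervalIntegrable (fun τ => G τ * evolve r P Z Y τ φ) volume 0 s := by
    intro φ hφ G hG
    rw [intervalIntegrable_iff_integrableOn_Ioc_of_le hs] at hG ⊢
    refine hG.mul_bdd (c := 1) (h.measurable_evolve_left hφ).aestronglyMeasurable ?_
    refine (ae_restrict_mem measurableSet_Ioc).mono fun τ hτ => ?_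
    have := h.evolve_mem hr hτ.1.le hφ
    rw [Real.norm_of_nonneg this.1]
    exact this.2
  have hexp : IntervalIntegrable (fun τ => r * Real.exp (r * τ)) volume 0 s :=
    Continuous.intervalIntegrable (by fun_prop) _ _
  have hprod : IntervalIntegrable (fun τ => r * Real.exp (r * τ) *
      ((∫ m, evolve r P Z Y τ (addPoint f (τ, m)) ∂ρ) * evolve r P Z Y τ g +
        evolve r P Z Y τ f * (∫ m, evolve r P Z Y τ (addPoint g (τ, m)) ∂ρ) -
        evolve r P Z Y τ f * evolve r P Z Y τ g)) volume 0 s := by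
    have h1 := ((hb hg hacf).add (hb hf hacg)).sub (hb hg (hb hf hexp))
    convert! h1 using 1
    ext τ
    ring
  -- Since `f` and `g` are uncorrelated without arrivals, the constant terms of the two renewal
  -- equations cancel.
  rw [evolveCov, mul_sub, efg, ip, hfg, add_sub_add_left_eq_sub,
    ← intervalIntegral.integral_sub hacfg hprod]
  refine intervalIntegral.integral_congr fun τ hτ => ?_
  rw [uIcc_of_le hs] at hτ
  have i1 := h.integrable_evolve_addPoint hr hτ.1 hf
  have i2 := h.integrable_evolve_addPoint hr hτ.1 hg
  have i3 := h.integrable_evolve_addPoint hr hτ.1 (hf.mul hg)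
  have e : ∀ m, evolveCov r P Z Y τ (addPoint f (τ, m)) (addPoint g (τ, m)) +
          (evolve r P Z Y τ (addPoint f (τ, m)) - evolve r P Z Y τ f) *
          (evolve r P Z Y τ (addPoint g (τ, m)) - evolve r P Z Y τ g) =
      evolve r P Z Y τ (addPoint (fun q => f q * g q) (τ, m)) -
        (evolve r P Z Y τ (addPoint f (τ, m)) * evolve r P Z Y τ g +
          evolve r P Z Y τ f * evolve r P Z Y τ (addPoint g (τ, m)) -
          evolve r P Z Y τ f * evolve r P Z Y τ g) := by
    intro m
    have : addPoint (fun q => f q * g q) (τ, m) =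
      fun q => addPoint f (τ, m) q * addPoint g (τ, m) q := rfl
    rw [this, evolveCov]
    ring
  simp only [e]
  have i4 : Integrable (fun m => evolve r P Z Y τ (addPoint f (τ, m)) * evolve r P Z Y τ g +
      evolve r P Z Y τ f * evolve r P Z Y τ (addPoint g (τ, m))) ρ :=
    (i1.mul_const _).add (i2.const_mul _)
  have i5 : Integrable (fun m => evolve r P Z Y τ (addPoint f (τ, m)) * evolve r P Z Y τ g +
      evolve r P Z Y τ f * evolve r P Z Y τ (addPoint g (τ, m)) -
      evolve r P Z Y τ f * evolve r P Z Y τ g) ρ := i4.sub (integrable_const _)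
  rw [integral_sub i3 i5, integral_sub i4 (integrable_const _),
    integral_add (i1.mul_const _) (i2.const_mul _), integral_mul_const, integral_const_mul]
  simp only [integral_const, probReal_univ, one_smul]
  ring

end IsMarkedPoisson

end JSQ

/-! ### The logistic flow and the comparison function -/

namespace JSQ

open Set

/-- The solution at time `s` of `x' = c x (1 - x / N)` with initial value `a`. -/
noncomputable def logistic (N c a s : ℝ) : ℝ :=
  N * a * Real.exp (c * s) / (N - a + a * Real.exp (c * s))

/-- The derivative of `logistic` with respect to the initial value. -/
noncomputable def logisticSlope (N c a s : ℝ) : ℝ :=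
  N ^ 2 * Real.exp (c * s) / (N - a + a * Real.exp (c * s)) ^ 2

section Logistic

variable {N c a b : ℝ} (hN : 0 < N) (ha : 0 ≤ a) (haN : a ≤ N)
include hN ha haN

lemma logistic_denom_pos (s : ℝ) : 0 < N - a + a * Real.exp (c * s) := by
  rcases ha.eq_or_lt with rfl | h
  · simpa using hN
  · have := Real.exp_pos (c * s)
    have : 0 < a * Real.exp (c * s) := by positivity
    linarith

lemma logistic_nonneg (s : ℝ) : 0 ≤ logistic N c a s := by
  have := logistic_denom_pos (c := c) hN ha haN s
  unfold logistic
  positivity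

lemma logisticSlope_nonneg (s : ℝ) : 0 ≤ logisticSlope N c a s := by
  have := logistic_denom_pos (c := c) hN ha haN s
  unfold logisticSlope
  positivity

/-- This is the flow identity: moving along the flow equals moving the initial value, so the time
derivative is the vector field at the starting point `a` times the derivative in the initial value.
This form, rather than `c x (1 - x/N)`, matches the growth rate `a (N - a)` of a group of servers.
-/
lemma hasDerivAt_logistic (s : ℝ) :
    HasDerivAt (logistic N c a) (c * a * (N - a) / N * logisticSlope N c a s) s := by
  have hd := logistic_denom_pos (c := c) hN ha haN s
  have h1 : HasDerivAt (fun s => Real.exp (c * s)) (Real.exp (c * s) * c) s := by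
    simpa using ((hasDerivAt_id s).const_mul c).exp
  have h2 := (h1.const_mul (N * a)).fun_div ((h1.const_mul a).const_add (N - a)) hd.ne'
  convert! h2 using 1
  unfold logisticSlope
  field_simp
  ring

lemma continuous_logistic : Continuous (logistic N c a) :=
  continuous_iff_continuousAt.2 fun s => (hasDerivAt_logistic hN ha haN s).continuousAt

lemma continuous_logisticSlope : Continuous (logisticSlope N c a) := by
  unfold logisticSlope
  refine Continuous.div (by fun_prop) (by fun_prop) fun s => ?_
  have := logistic_denom_pos (c := c) hN ha haN s
  positivity

omit ha haN in
lemma logistic_zero : logistic N c a 0 = a := by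
  unfold logistic
  simp only [mul_zero, Real.exp_zero, mul_one, sub_add_cancel]
  field_simp

/-- The logistic flow is concave in its initial value at nonnegative times. Concretely, the
difference quotient has the product of the denominators at `a` and `a + δ` where the slope has the
square of the one at `a`, and the denominator increases with the initial value because `exp (c s) ≥
1`. -/
lemma logistic_add_le {δ s : ℝ} (hc : 0 ≤ c) (hs : 0 ≤ s) (hδ : 0 ≤ δ) (hδN : a + δ ≤ N) :
    logistic N c (a + δ) s ≤ logistic N c a s + δ * logisticSlope N c a s := by
  have h1 := logistic_denom_pos (c := c) hN ha haN s
  have h2 := logistic_denom_pos (c := c) (a := a + δ) hN (by linarith) hδN s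
  have hu : 1 ≤ Real.exp (c * s) := Real.one_le_exp (by positivity)
  have h3 : N - a + a * Real.exp (c * s) ≤ N - (a + δ) + (a + δ) * Real.exp (c * s) := by
    have := mul_nonneg hδ (sub_nonneg.2 hu)
    linarith
  have e : logistic N c (a + δ) s - logistic N c a s = δ * (N ^ 2 * Real.exp (c * s) /
      ((N - a + a * Real.exp (c * s)) * (N - (a + δ) + (a + δ) * Real.exp (c * s)))) := by
    unfold logistic
    field_simp
    ring
  have h4 : N ^ 2 * Real.exp (c * s) /
      ((N - a + a * Real.exp (c * s)) * (N - (a + δ) + (a + δ) * Real.exp (c * s))) ≤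
      logisticSlope N c a s := by
    unfold logisticSlope
    rw [sq (N - a + a * Real.exp (c * s))]
    gcongr
  have := mul_le_mul_of_nonneg_left h4 hδ
  linarith

end Logistic

/-- The bound for the covariance of functions of two disjoint groups of servers. -/
noncomputable def covBound (N c C a b s : ℝ) : ℝ :=
  C * ∫ σ in 0..s, logistic N c a σ * logistic N c b σ

/-- A bound for the derivative of `covBound` with respect to the size of the first group. -/
noncomputable def covBoundSlope (N c C a b s : ℝ) : ℝ :=
  C * ∫ σ in 0..s, logisticSlope N c a σ * logistic N c b σ

lemma covBound_comm (N c C a b s : ℝ) : covBound N c C a b s = covBound N c C b a s := by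
  simp only [covBound, mul_comm (logistic N c a _)]

section CovBound

variable {N c C a b : ℝ} (hN : 0 < N) (ha : 0 ≤ a) (haN : a ≤ N) (hb : 0 ≤ b) (hbN : b ≤ N)
  (hC : 0 ≤ C)
include hN ha haN hb hbN

lemma hasDerivAt_covBound (s : ℝ) :
    HasDerivAt (covBound N c C a b) (C * (logistic N c a s * logistic N c b s)) s := by
  have h1 : Continuous fun σ => logistic N c a σ * logistic N c b σ :=
    (continuous_logistic hN ha haN).mul (continuous_logistic hN hb hbN)
  exact (h1.integral_hasStrictDerivAt 0 s).hasDerivAt.const_mul C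

lemma continuous_covBound : Continuous (covBound N c C a b) :=
  continuous_iff_continuousAt.2 fun s =>
    (hasDerivAt_covBound hN ha haN hb hbN s).continuousAt

include hC

lemma covBound_nonneg {s : ℝ} (hs : 0 ≤ s) : 0 ≤ covBound N c C a b s :=
  mul_nonneg hC (intervalIntegral.integral_nonneg hs fun σ _ =>
    mul_nonneg (logistic_nonneg hN ha haN σ) (logistic_nonneg hN hb hbN σ))

lemma covBoundSlope_nonneg {s : ℝ} (hs : 0 ≤ s) : 0 ≤ covBoundSlope N c C a b s :=
  mul_nonneg hC (intervalIntegral.integral_nonneg hs fun σ _ =>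
    mul_nonneg (logisticSlope_nonneg hN ha haN σ) (logistic_nonneg hN hb hbN σ))

lemma covBound_add_le {δ s : ℝ} (hc : 0 ≤ c) (hs : 0 ≤ s) (hδ : 0 ≤ δ) (hδN : a + δ ≤ N) :
    covBound N c C (a + δ) b s ≤ covBound N c C a b s + δ * covBoundSlope N c C a b s := by
  have i1 := ((continuous_logistic (c := c) hN ha haN).fun_mul
    (continuous_logistic (c := c) hN hb hbN)).intervalIntegrable (μ := volume) 0 s
  have i2 := ((continuous_logisticSlope (c := c) hN ha haN).fun_mul
    (continuous_logistic (c := c) hN hb hbN)).intervalIntegrable (μ := volume) 0 s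
  have i3 := ((continuous_logistic (c := c) hN (by linarith : 0 ≤ a + δ) hδN).fun_mul
    (continuous_logistic (c := c) hN hb hbN)).intervalIntegrable (μ := volume) 0 s
  have key : ∫ σ in 0..s, logistic N c (a + δ) σ * logistic N c b σ ≤
      (∫ σ in 0..s, logistic N c a σ * logistic N c b σ) +
        δ * ∫ σ in 0..s, logisticSlope N c a σ * logistic N c b σ := by
    rw [← intervalIntegral.integral_const_mul, ← intervalIntegral.integral_add i1
      (i2.const_mul δ)]
    refine intervalIntegral.integral_mono_on hs i3 (i1.add (i2.const_mul δ)) fun σ hσ => ?_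
    have := mul_le_mul_of_nonneg_right (logistic_add_le hN ha haN hc hσ.1 hδ hδN)
      (logistic_nonneg (c := c) hN hb hbN σ)
    calc _ ≤ _ := this
      _ = _ := by ring
  unfold covBound covBoundSlope
  calc _ ≤ _ := mul_le_mul_of_nonneg_left key hC
    _ = _ := by ring

/-- `covBound` is a supersolution of the equation for the covariances; `p` bounds the probability
of sampling two given servers. -/
lemma covBound_supersolution {r p s : ℝ} (hs : 0 ≤ s) (hpc : r * p * N ≤ c)
    (hpC : 2 * (r * p) ≤ C) :
    r * p * (2 * (a * b) + a * (N - a) * covBoundSlope N c C a b s +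
      b * (N - b) * covBoundSlope N c C b a s) ≤ C * (logistic N c a s * logistic N c b s) := by
  have i1 := ((continuous_logisticSlope (c := c) hN ha haN).fun_mul
    (continuous_logistic (c := c) hN hb hbN)).intervalIntegrable (μ := volume) 0 s
  have i2 := ((continuous_logistic (c := c) hN ha haN).fun_mul
    (continuous_logisticSlope (c := c) hN hb hbN)).intervalIntegrable (μ := volume) 0 s
  -- By the flow identity, the integrand is the derivative of `x_a x_b`.
  have e : (∫ σ in 0..s, c * a * (N - a) / N * (logisticSlope N c a σ * logistic N c b σ) +
      c * b * (N - b) / N * (logistic N c a σ * logisticSlope N c b σ)) =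
      logistic N c a s * logistic N c b s - a * b := by
    have := intervalIntegral.integral_eq_sub_of_hasDerivAt
      (f := fun σ => logistic N c a σ * logistic N c b σ)
      (f' := fun σ => c * a * (N - a) / N * (logisticSlope N c a σ * logistic N c b σ) +
      c * b * (N - b) / N * (logistic N c a σ * logisticSlope N c b σ)) (a := 0) (b := s)
      (fun σ _ => by
        convert! (hasDerivAt_logistic (c := c) hN ha haN σ).fun_mul
          (hasDerivAt_logistic (c := c) hN hb hbN σ) using 1
        ring) ((i1.const_mul _).add (i2.const_mul _))
    rw [this, logistic_zero hN, logistic_zero hN]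
  rw [intervalIntegral.integral_add (i1.const_mul _) (i2.const_mul _),
    intervalIntegral.integral_const_mul, intervalIntegral.integral_const_mul] at e
  have e2 : covBoundSlope N c C b a s =
      C * ∫ σ in 0..s, logistic N c a σ * logisticSlope N c b σ := by
    simp only [covBoundSlope, mul_comm (logistic N c a _)]
  have hrp : r * p ≤ c / N := by rw [le_div_iff₀ hN]; exact hpc
  have n1 := covBoundSlope_nonneg (c := c) hN ha haN hb hbN hC hs
  have n2 := covBoundSlope_nonneg (c := c) hN hb hbN ha haN hC hs
  have t1 : r * p * (2 * (a * b)) ≤ C * (a * b) := by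
    have := mul_le_mul_of_nonneg_right hpC (mul_nonneg ha hb)
    linarith
  have t2 : r * p * (a * (N - a) * covBoundSlope N c C a b s) ≤
      c / N * (a * (N - a) * covBoundSlope N c C a b s) :=
    mul_le_mul_of_nonneg_right hrp (mul_nonneg (mul_nonneg ha (sub_nonneg.2 haN)) n1)
  have t3 : r * p * (b * (N - b) * covBoundSlope N c C b a s) ≤
      c / N * (b * (N - b) * covBoundSlope N c C b a s) :=
    mul_le_mul_of_nonneg_right hrp (mul_nonneg (mul_nonneg hb (sub_nonneg.2 hbN)) n2)
  -- Once `2 r p` is replaced by `C` in the first term and `r p` by `c / N` in the others, the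
  -- supersolution inequality is an equality.
  have e3 : C * (a * b) + c / N * (a * (N - a) * covBoundSlope N c C a b s) +
      c / N * (b * (N - b) * covBoundSlope N c C b a s) =
      C * (logistic N c a s * logistic N c b s) := by
    rw [e2, covBoundSlope]
    linear_combination C * e
  linarith

omit hC in
/-- The integrated form of `covBound_supersolution`. -/
lemma integral_exp_mul_covBound {r s : ℝ} :
    ∫ τ in 0..s, Real.exp (r * τ) *
      (r * covBound N c C a b τ + C * (logistic N c a τ * logistic N c b τ)) =
    Real.exp (r * s) * covBound N c C a b s := by
  have hd : ∀ τ ∈ uIcc 0 s, HasDerivAt (fun τ => Real.exp (r * τ) * covBound N c C a b τ)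
      (Real.exp (r * τ) *
      (r * covBound N c C a b τ + C * (logistic N c a τ * logistic N c b τ))) τ := fun τ _ => by
    have h1 : HasDerivAt (fun τ => Real.exp (r * τ)) (Real.exp (r * τ) * r) τ := by
      simpa using ((hasDerivAt_id τ).const_mul r).exp
    convert! h1.fun_mul (hasDerivAt_covBound (c := c) (C := C) hN ha haN hb hbN τ) using 1
    ring
  rw [intervalIntegral.integral_eq_sub_of_hasDerivAt hd]
  · simp [covBound]
  · refine Continuous.intervalIntegrable ?_ _ _
    have h1 := continuous_logistic (c := c) hN ha haN
    have h2 := continuous_logistic (c := c) hN hb hbN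
    have h3 := continuous_covBound (c := c) (C := C) hN ha haN hb hbN
    fun_prop

end CovBound

/-- The remainder of the Picard iteration. -/
lemma integral_exp_mul_pow_le {r s : ℝ} (hr : 0 < r) (hs : 0 ≤ s) (n : ℕ) :
    ∫ τ in 0..s, r * Real.exp (r * τ) * ((r * τ) ^ n / (n.factorial : ℝ)) ≤
      Real.exp (r * s) * ((r * s) ^ (n + 1) / ((n + 1).factorial : ℝ)) := by
  have h1 : ∫ τ in 0..s, r * Real.exp (r * τ) * ((r * τ) ^ n / (n.factorial : ℝ)) ≤
      ∫ τ in 0..s, (r ^ (n + 1) * Real.exp (r * s) / (n.factorial : ℝ)) * τ ^ n := by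
    refine intervalIntegral.integral_mono_on hs (Continuous.intervalIntegrable (by fun_prop) _ _)
      (Continuous.intervalIntegrable (by fun_prop) _ _) fun τ hτ => ?_
    have h0 := hτ.1
    have h2 := hτ.2
    have h3 : Real.exp (r * τ) ≤ Real.exp (r * s) := by gcongr
    calc r * Real.exp (r * τ) * ((r * τ) ^ n / (n.factorial : ℝ))
        ≤ r * Real.exp (r * s) * ((r * τ) ^ n / (n.factorial : ℝ)) := by gcongr
      _ = _ := by rw [mul_pow]; ring
  refine h1.trans_eq ?_
  rw [intervalIntegral.integral_const_mul, integral_pow, Nat.factorial_succ]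
  have : (n.factorial : ℝ) ≠ 0 := by positivity
  push_cast
  field_simp
  ring

end JSQ

/-! ### Routing as a function of the list of arrivals -/

namespace JSQ

section Routing

variable {N : ℕ} (pol : ServicePolicy) (ξ : Fin N → ℕ)

/-- The set of sampled servers, the ranking of the servers, the requirement and the mark attached
to an arrival. -/
abbrev ArrivalMark (N : ℕ) := Finset (Fin N) × Equiv.Perm (Fin N) × ℝ≥0 × ℝ

open Classical in
/-- The tasks routed to a server, as a function of the list of arrival times and marks, latest
arrival first, and of the initial tasks. -/
noncomputable def route : List (ℝ × ArrivalMark N) → InitialData ξ → Fin N → List Task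
  | [], y, i => List.ofFn (fun m => ((0 : ℝ), y i m))
  | p :: L, y, i =>
    if IsSelected (fun j => pol.queueLength (route L y j) p.1) p.2.1 p.2.2.1 i
    then route L y i ++ [(p.1, p.2.2.2)]
    else route L y i

lemma arrivalTime_eq (z : ℕ → ArrivalData N) (n : ℕ) :
    arrivalTime z n = lastTime (hist z (n + 1)) := by
  rw [lastTime_hist, arrivalTime]

lemma arrivalCount_eq (z : ℕ → ArrivalData N) (t : ℝ) : arrivalCount z t = pointCount z t := by
  simp only [arrivalCount, pointCount, arrivalTime_eq]

lemma routed_eq (y : InitialData ξ) (z : ℕ → ArrivalData N) (n : ℕ) :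
    routed pol ξ y z n = route pol ξ (hist z n) y := by
  induction n with
  | zero => rfl
  | succ n ih =>
    ext1 i
    simp only [routed]
    rw [ih, arrivalTime_eq]
    rfl

/-- The function `f` of the past depends on it only through the tasks routed to the servers
in `A`. -/
def DependsOnServers {δ : Type*} (A : Finset (Fin N))
    (f : List (ℝ × ArrivalMark N) × InitialData ξ → δ) : Prop :=
  ∀ L y L' y', (∀ j ∈ A, route pol ξ L y j = route pol ξ L' y' j) → f (L, y) = f (L', y')

variable {pol ξ}

lemma route_cons_of_notMem {p : ℝ × ArrivalMark N} {i : Fin N} (hi : i ∉ p.2.1)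
    (L : List (ℝ × ArrivalMark N)) (y : InitialData ξ) :
    route pol ξ (p :: L) y i = route pol ξ L y i := by
  simp only [route]
  exact if_neg fun h => hi h.1

/-- An arrival joins a sampled server only, so it leaves the lists of all unsampled servers
unchanged. -/
lemma DependsOnServers.addPoint_eq {δ : Type*} {A : Finset (Fin N)}
    {f : List (ℝ × ArrivalMark N) × InitialData ξ → δ} (hf : DependsOnServers pol ξ A f)
    {p : ℝ × ArrivalMark N} (hp : Disjoint A p.2.1) : addPoint f p = f := by
  ext ⟨L, y⟩
  exact hf _ _ _ _ fun j hj => route_cons_of_notMem (Finset.disjoint_left.1 hp hj) L y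

/-- Whether a sampled server gets the task is decided by the queues at the sampled servers and the
ranking contained in the mark. Dependence thus spreads to the sampled set and no further. -/
lemma DependsOnServers.addPoint {δ : Type*} {A : Finset (Fin N)}
    {f : List (ℝ × ArrivalMark N) × InitialData ξ → δ} (hf : DependsOnServers pol ξ A f)
    (p : ℝ × ArrivalMark N) : DependsOnServers pol ξ (A ∪ p.2.1) (addPoint f p) := by
  classical
  intro L y L' y' h
  refine hf _ _ _ _ fun j hj => ?_
  by_cases hS : j ∈ p.2.1
  · have e : IsSelected (fun j => pol.queueLength (route pol ξ L y j) p.1) p.2.1 p.2.2.1 j ↔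
        IsSelected (fun j => pol.queueLength (route pol ξ L' y' j) p.1) p.2.1 p.2.2.1 j := by
      refine and_congr_right fun _ => forall₂_congr fun k hk => ?_
      beta_reduce
      rw [h k (Finset.mem_union_right _ hk), h j (Finset.mem_union_left _ hj)]
    have hj' := h j (Finset.mem_union_left _ hj)
    simp only [route]
    exact if_congr e (by rw [hj']) hj'
  · rw [route_cons_of_notMem hS, route_cons_of_notMem hS, h j (Finset.mem_union_left _ hj)]

/-- With no arrivals, a function that depends on the servers in `A` is a function of the initial
tasks at these servers. -/
lemma DependsOnServers.nil_congr {δ : Type*} {A : Finset (Fin N)}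
    {f : List (ℝ × ArrivalMark N) × InitialData ξ → δ} (hf : DependsOnServers pol ξ A f)
    {y y' : InitialData ξ} (h : ∀ j ∈ A, y j = y' j) : f ([], y) = f ([], y') :=
  hf _ _ _ _ fun j hj => by simp only [route, h j hj]

/-- For a fixed number of routed tasks, the queue length is a finite sum of indicators, each
measurable by the measurability of the policy. -/
lemma measurable_queueLength :
    Measurable fun p : List Task × ℝ => pol.queueLength p.1 p.2 := by
  classical
  refine measurable_from_list_prod fun n => ?_
  have e : (fun p : (Fin n → Task) × ℝ => pol.queueLength (List.ofFn p.1) p.2) = fun p =>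
      ∑ j : Fin n, if (p.1 j).arrival ≤ p.2 ∧ pol.served (List.ofFn p.1) j p.2 < (p.1 j).size
        then 1 else 0 := by
    ext1 p
    rw [ServicePolicy.queueLength, numPresent, Finset.card_filter]
    refine Fintype.sum_equiv (finCongr (by simp)) _ _ fun j => ?_
    simp only [List.get_ofFn]
    rfl
  rw [e]
  refine Finset.measurable_sum _ fun j _ => Measurable.ite ?_ measurable_const measurable_const
  have hj : Measurable fun p : (Fin n → Task) × ℝ => p.1 j :=
    (measurable_pi_apply j).comp measurable_fst
  refine (measurableSet_le hj.fst measurable_snd).inter ?_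
  exact measurableSet_lt (pol.measurable_served n j) (measurable_subtype_coe.comp hj.snd.fst)

instance permMeasurableSingletonClass (N : ℕ) :
    MeasurableSingletonClass (Equiv.Perm (Fin N)) := ⟨fun _ => trivial⟩

lemma measurableSet_isSelected (i : Fin N) :
    MeasurableSet {p : (Fin N → ℕ) × Finset (Fin N) × Equiv.Perm (Fin N) |
      IsSelected p.1 p.2.1 p.2.2 i} :=
  (Set.to_countable _).measurableSet

/-- By induction on the number of arrivals. The selection rule lives on a countable discrete space,
so only the queue lengths and the appended task require an argument. -/
lemma measurable_route (i : Fin N) :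
    Measurable fun q : List (ℝ × ArrivalMark N) × InitialData ξ => route pol ξ q.1 q.2 i := by
  refine measurable_from_list_prod fun n => ?_
  induction n generalizing i with
  | zero =>
    simp only [List.ofFn_zero, route]
    refine (measurable_ofFn _).comp (measurable_pi_lambda _ fun m => ?_)
    exact measurable_const.prodMk
      ((measurable_pi_apply m).comp ((measurable_pi_apply i).comp measurable_snd))
  | succ n ih =>
    let τ : (Fin (n + 1) → ℝ × ArrivalMark N) × InitialData ξ →
      (Fin n → ℝ × ArrivalMark N) × InitialData ξ := fun q => (fun k => q.1 k.succ, q.2)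
    have hτ : Measurable τ := by
      refine Measurable.prodMk (measurable_pi_lambda _ fun k => ?_) measurable_snd
      exact (measurable_pi_apply (Fin.succ k)).comp measurable_fst
    have h0 : Measurable fun q : (Fin (n + 1) → ℝ × ArrivalMark N) × InitialData ξ => q.1 0 :=
      (measurable_pi_apply 0).comp measurable_fst
    have hR := fun j => (ih j).comp hτ
    simp only [List.ofFn_succ, route]
    refine Measurable.ite ?_ ?_ (hR i)
    · refine (measurableSet_isSelected i).preimage (f := fun q =>
        (fun j => pol.queueLength (route pol ξ (List.ofFn (τ q).1) (τ q).2 j) (q.1 0).1,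
          (q.1 0).2.1, (q.1 0).2.2.1)) ?_
      refine Measurable.prodMk (measurable_pi_lambda _ fun j => ?_)
        (h0.snd.fst.prodMk h0.snd.snd.fst)
      exact measurable_queueLength.comp ((hR j).prodMk h0.fst)
    · exact measurable_concat.comp ((hR i).prodMk (h0.fst.prodMk h0.snd.snd.snd))

end Routing

/-! ### The probability of sampling two given servers -/

section Sampling

variable {N D : ℕ}

/-- The law of the marks of the arrivals. -/
noncomputable def markLaw (N D : ℕ) (ν : Measure (ℝ≥0 × ℝ)) : Measure (ArrivalMark N) :=
  (uniformOn {S : Finset (Fin N) | S.card = D}).prod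
    ((uniformOn (Set.univ : Set (Equiv.Perm (Fin N)))).prod ν)

lemma isProbabilityMeasure_sampling (hDN : D ≤ N) :
    IsProbabilityMeasure (uniformOn {S : Finset (Fin N) | S.card = D}) := by
  refine isProbabilityMeasure_uniformOn (Set.toFinite _) ?_
  obtain ⟨S, -, hS⟩ := Finset.exists_subset_card_eq (s := (Finset.univ : Finset (Fin N))) (n := D)
    (by simpa using hDN)
  exact ⟨S, hS⟩

lemma isProbabilityMeasure_markLaw (hDN : D ≤ N) (ν : Measure (ℝ≥0 × ℝ))
    [IsProbabilityMeasure ν] : IsProbabilityMeasure (markLaw N D ν) := by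
  have := isProbabilityMeasure_sampling hDN
  unfold markLaw
  infer_instance

/-- Two given servers are sampled with probability at most `D (D - 1) / (N (N - 1))`. -/
lemma sampling_pair_le (hDN : D ≤ N) {i j : Fin N} (hij : i ≠ j) :
    (uniformOn {S : Finset (Fin N) | S.card = D}).real {S | i ∈ S ∧ j ∈ S} ≤
      (D * (D - 1) : ℝ) / (N * (N - 1)) := by
  classical
  have hN : 2 ≤ N := by
    have := Finset.card_le_univ ({i, j} : Finset (Fin N))
    rwa [Finset.card_pair hij, Fintype.card_fin] at this
  have hN' : (2 : ℝ) ≤ N := by exact_mod_cast hN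
  let s : Finset (Finset (Fin N)) := Finset.powersetCard D Finset.univ
  let t : Finset (Finset (Fin N)) := Finset.univ.filter fun S => i ∈ S ∧ j ∈ S
  have hs : {S : Finset (Fin N) | S.card = D} = (s : Set (Finset (Fin N))) := by
    ext S; simp [s]
  have ht : {S : Finset (Fin N) | i ∈ S ∧ j ∈ S} = (t : Set (Finset (Fin N))) := by
    ext S; simp [t]
  rw [hs, ht, Measure.real, uniformOn_apply_finset, ENNReal.toReal_div, ENNReal.toReal_natCast,
    ENNReal.toReal_natCast]
  have hcs : s.card = N.choose D := by simp [s]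
  have hpos : 0 < N.choose D := Nat.choose_pos hDN
  have key : (s ∩ t).card * (N * (N - 1)) ≤ D * (D - 1) * N.choose D := by
    -- The subtraction `D - 2` used for the count is truncated, so `D < 2` is treated apart: then no
    -- sampled set contains both servers.
    rcases Nat.lt_or_ge D 2 with hD | hD
    · have : s ∩ t = ∅ := by
        refine Finset.eq_empty_of_forall_notMem fun S hS => ?_
        simp only [Finset.mem_inter, s, t, Finset.mem_powersetCard_univ, Finset.mem_filter,
          Finset.mem_univ, true_and] at hS
        have h1 : ({i, j} : Finset (Fin N)).card ≤ S.card := Finset.card_le_card fun k hk => by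
          simp only [Finset.mem_insert, Finset.mem_singleton] at hk
          rcases hk with rfl | rfl
          · exact hS.2.1
          · exact hS.2.2
        rw [Finset.card_pair hij] at h1
        omega
      simp [this]
    · have h1 : (s ∩ t).card ≤ (Finset.powersetCard (D - 2) (Finset.univ \ {i, j})).card := by
        refine Finset.card_le_card_of_injOn (fun S => S \ {i, j}) (fun S hS => ?_)
          fun S hS S' hS' h => ?_
        · simp only [Finset.coe_inter, Set.mem_inter_iff, Finset.mem_coe, s, t,
            Finset.mem_powersetCard_univ, Finset.mem_filter, Finset.mem_univ, true_and] at hS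
          rw [Finset.mem_coe, Finset.mem_powersetCard]
          refine ⟨Finset.sdiff_subset_sdiff (Finset.subset_univ _) le_rfl, ?_⟩
          rw [Finset.card_sdiff_of_subset, hS.1, Finset.card_pair hij]
          intro k hk
          simp only [Finset.mem_insert, Finset.mem_singleton] at hk
          rcases hk with rfl | rfl
          · exact hS.2.1
          · exact hS.2.2
        · simp only [Finset.coe_inter, Set.mem_inter_iff, Finset.mem_coe, s, t,
            Finset.mem_powersetCard_univ, Finset.mem_filter, Finset.mem_univ, true_and] at hS hS'
          ext k
          by_cases hk : k = i ∨ k = j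
          · rcases hk with rfl | rfl
            · simp [hS.2.1, hS'.2.1]
            · simp [hS.2.2, hS'.2.2]
          · have := congrArg (k ∈ ·) h
            simpa [hk] using this
      rw [Finset.card_powersetCard, Finset.card_sdiff_of_subset (Finset.subset_univ _),
        Finset.card_pair hij, Finset.card_univ, Fintype.card_fin] at h1
      obtain ⟨D', rfl⟩ := Nat.exists_eq_add_of_le' hD
      obtain ⟨N', rfl⟩ := Nat.exists_eq_add_of_le' hN
      -- The absorption identity, applied twice, turns `N (N - 1)` times the number of `(D -
      -- 2)`-subsets of `N - 2` servers into `D (D - 1)` times the number of `D`-subsets of `N`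
      -- servers.
      have c1 := Nat.add_one_mul_choose_eq (N' + 1) (D' + 1)
      have c2 := Nat.add_one_mul_choose_eq N' D'
      simp only [Nat.add_sub_cancel] at h1
      simp only [show N' + 2 - 1 = N' + 1 by omega, show D' + 2 - 1 = D' + 1 by omega]
      calc _ ≤ N'.choose D' * ((N' + 2) * (N' + 1)) := Nat.mul_le_mul_right _ h1
        _ = (N' + 2) * ((N' + 1) * N'.choose D') := by ring
        _ = (N' + 1 + 1) * (N' + 1).choose (D' + 1) * (D' + 1) := by rw [c2]; ring
        _ = _ := by rw [c1]; ring
  have key' : ((s ∩ t).card : ℝ) * (N * (N - 1)) ≤ D * (D - 1) * N.choose D := by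
    have hc : (((s ∩ t).card * (N * (N - 1)) : ℕ) : ℝ) ≤ ((D * (D - 1) * N.choose D : ℕ) : ℝ) := by
      exact_mod_cast key
    push_cast [Nat.cast_sub (show 1 ≤ N by omega)] at hc
    rcases Nat.eq_zero_or_pos D with rfl | hD
    · simpa using hc
    · rwa [Nat.cast_sub (show 1 ≤ D from hD), Nat.cast_one] at hc
  rw [hcs, div_le_div_iff₀ (by exact_mod_cast hpos) (by nlinarith)]
  exact key'

end Sampling

end JSQ

/-! ### Decoupling of disjoint groups of servers -/

namespace JSQ

open Set

section PairCount

variable {N : ℕ}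

/-- The number of pairs of sampled servers, the first in `A` and the second in `B`. -/
noncomputable def pairCount (A B : Finset (Fin N)) (m : ArrivalMark N) : ℝ :=
  ∑ i ∈ A, ∑ j ∈ B, {m : ArrivalMark N | i ∈ m.1 ∧ j ∈ m.1}.indicator (fun _ => (1 : ℝ)) m

lemma pairCount_nonneg (A B : Finset (Fin N)) (m : ArrivalMark N) : 0 ≤ pairCount A B m :=
  Finset.sum_nonneg fun _ _ => Finset.sum_nonneg fun _ _ => indicator_nonneg (by simp) _

/-- One sampled server of `A` already forms a pair with each sampled server of `B`. With `B` the
complement of `A` this bounds the growth of `A`; for disjoint `A` and `B` it yields `1 ≤ pairCount A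
B m` when both are hit. In each case the expectation involves only pair probabilities. -/
lemma card_inter_le_pairCount {A : Finset (Fin N)} (B : Finset (Fin N)) {m : ArrivalMark N}
    (h : ¬ Disjoint A m.1) : ((B ∩ m.1).card : ℝ) ≤ pairCount A B m := by
  classical
  obtain ⟨i, hi, him⟩ := Finset.not_disjoint_iff.1 h
  have h1 : ((B ∩ m.1).card : ℝ) =
      ∑ j ∈ B, {m : ArrivalMark N | i ∈ m.1 ∧ j ∈ m.1}.indicator (fun _ => (1 : ℝ)) m := by
    rw [← Finset.filter_mem_eq_inter, Finset.card_filter]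
    push_cast
    refine Finset.sum_congr rfl fun j _ => ?_
    simp [indicator, him]
  rw [h1]
  exact Finset.single_le_sum (f := fun i => ∑ j ∈ B,
    {m : ArrivalMark N | i ∈ m.1 ∧ j ∈ m.1}.indicator (fun _ => (1 : ℝ)) m)
    (fun _ _ => Finset.sum_nonneg fun _ _ => indicator_nonneg (by simp) _) hi

lemma measurableSet_pair (i j : Fin N) :
    MeasurableSet {m : ArrivalMark N | i ∈ m.1 ∧ j ∈ m.1} :=
  (toFinite {S : Finset (Fin N) | i ∈ S ∧ j ∈ S}).measurableSet.preimage measurable_fst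

variable {ρ : Measure (ArrivalMark N)} [IsProbabilityMeasure ρ]

lemma integrable_pairCount (A B : Finset (Fin N)) : Integrable (pairCount A B) ρ :=
  integrable_finsetSum _ fun i _ => integrable_finsetSum _ fun j _ =>
    (integrable_const _).indicator (measurableSet_pair i j)

lemma integral_pairCount_le {A B : Finset (Fin N)} (hAB : Disjoint A B) {p : ℝ}
    (hp : ∀ i j : Fin N, i ≠ j → ρ.real {m | i ∈ m.1 ∧ j ∈ m.1} ≤ p) :
    ∫ m, pairCount A B m ∂ρ ≤ A.card * B.card * p := by
  have hint : ∀ i j : Fin N, Integrable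
      ({m : ArrivalMark N | i ∈ m.1 ∧ j ∈ m.1}.indicator (fun _ => (1 : ℝ))) ρ :=
    fun i j => (integrable_const _).indicator (measurableSet_pair i j)
  unfold pairCount
  rw [integral_finsetSum _ fun i _ => integrable_finsetSum _ fun j _ => hint i j]
  calc _ ≤ ∑ i ∈ A, ∑ j ∈ B, p := by
        refine Finset.sum_le_sum fun i hi => ?_
        rw [integral_finsetSum _ fun j _ => hint i j]
        refine Finset.sum_le_sum fun j hj => ?_
        rw [integral_indicator (measurableSet_pair i j)]
        simpa using hp i j fun hij => Finset.disjoint_left.1 hAB hi (hij ▸ hj)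
    _ = A.card * B.card * p := by simp; ring

end PairCount

section Decoupling

variable {N : ℕ} {pol : ServicePolicy} {ξ : Fin N → ℕ} {Ω : Type*} [MeasurableSpace Ω]
  {r : ℝ} {ρ : Measure (ArrivalMark N)} {P : Measure Ω} {Z : ℕ → Ω → ℝ × ArrivalMark N}
  {Y : Ω → InitialData ξ} [IsProbabilityMeasure P] [IsProbabilityMeasure ρ]

/-- Concavity makes the increase of the bound at most linear in the number of new servers, so that
its expectation can be taken. -/
lemma covBound_union_le {N : ℕ} (hN : 0 < N) {c C : ℝ} (hc : 0 ≤ c) (hC : 0 ≤ C)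
    {s : ℝ} (hs : 0 ≤ s) {A B : Finset (Fin N)} {m : ArrivalMark N} (hm : ¬ Disjoint A m.1) :
    covBound N c C (A ∪ m.1).card B.card s ≤ covBound N c C A.card B.card s +
      pairCount A Aᶜ m * covBoundSlope N c C A.card B.card s := by
  have hN' : (0 : ℝ) < N := by exact_mod_cast hN
  have hle : ∀ A : Finset (Fin N), (A.card : ℝ) ≤ N := fun A => by
    exact_mod_cast (Finset.card_le_univ A).trans_eq (Fintype.card_fin N)
  have h1 : ((A ∪ m.1).card : ℝ) = A.card + (Aᶜ ∩ m.1).card := by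
    rw [← Finset.union_sdiff_self_eq_union, Finset.card_union_of_disjoint Finset.disjoint_sdiff]
    have : Aᶜ ∩ m.1 = m.1 \ A := by ext k; simp [and_comm]
    rw [this]
    push_cast
    rfl
  have h2 := covBound_add_le (c := c) (C := C) hN' (Nat.cast_nonneg A.card) (hle A)
    (Nat.cast_nonneg B.card) (hle B) hC hc hs (Nat.cast_nonneg (Aᶜ ∩ m.1).card)
    (by rw [← h1]; exact hle _)
  rw [h1]
  refine h2.trans (add_le_add_right ?_ _)
  exact mul_le_mul_of_nonneg_right (card_inter_le_pairCount _ hm)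
    (covBoundSlope_nonneg hN' (Nat.cast_nonneg _) (hle A) (Nat.cast_nonneg _) (hle B) hC hs)

/-- Functions of disjoint groups of servers are almost uncorrelated; `n` counts the steps of a
Picard iteration. -/
lemma abs_evolveCov_le_add (hN : 0 < N) (hr : 0 < r) (h : IsMarkedPoisson r ρ P Z Y)
    (hbase : ∀ (A B : Finset (Fin N)), Disjoint A B →
      ∀ f g : List (ℝ × ArrivalMark N) × InitialData ξ → ℝ, IsUnitValued f → IsUnitValued g →
      DependsOnServers pol ξ A f → DependsOnServers pol ξ B g →
      ∫ ω, f ([], Y ω) * g ([], Y ω) ∂P = (∫ ω, f ([], Y ω) ∂P) * ∫ ω, g ([], Y ω) ∂P)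
    {c C p : ℝ} (hc : 0 ≤ c) (hC : 0 ≤ C) (hpc : r * p * N ≤ c) (hpC : 2 * (r * p) ≤ C)
    (hp : ∀ i j : Fin N, i ≠ j → ρ.real {m | i ∈ m.1 ∧ j ∈ m.1} ≤ p) (n : ℕ)
    {A B : Finset (Fin N)} (hAB : Disjoint A B)
    {f g : List (ℝ × ArrivalMark N) × InitialData ξ → ℝ} (hf : IsUnitValued f)
    (hg : IsUnitValued g) (hfA : DependsOnServers pol ξ A f) (hgB : DependsOnServers pol ξ B g)
    {s : ℝ} (hs : 0 ≤ s) :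
    |evolveCov r P Z Y s f g| ≤
      covBound N c C A.card B.card s + (r * s) ^ n / (n.factorial : ℝ) := by
  classical
  have hN' : (0 : ℝ) < N := by exact_mod_cast hN
  have hle : ∀ A : Finset (Fin N), (A.card : ℝ) ≤ N := fun A => by
    exact_mod_cast (Finset.card_le_univ A).trans_eq (Fintype.card_fin N)
  have h0 : ∀ A : Finset (Fin N), (0 : ℝ) ≤ A.card := fun A => Nat.cast_nonneg _
  -- The groups and the functions must vary, since an arrival replaces them by larger groups and by
  -- `addPoint f` or `addPoint g`. For `n = 0` the remainder is `1`, which bounds any covariance of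
  -- functions with values in `[0, 1]`.
  induction n generalizing A B f g s with
  | zero =>
    have h1 := h.abs_evolveCov_le_one hr hs hf hg
    have h2 := covBound_nonneg (c := c) hN' (h0 A) (hle A) (h0 B) (hle B) hC hs
    simp only [pow_zero, Nat.factorial_zero, Nat.cast_one, div_one]
    linarith
  | succ n ih =>
    let R : ℝ → ℝ := fun τ => (r * τ) ^ n / (n.factorial : ℝ)
    let K : ℝ → ℝ := covBound N c C A.card B.card
    let KA : ℝ → ℝ := covBoundSlope N c C A.card B.card
    let KB : ℝ → ℝ := covBoundSlope N c C B.card A.card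
    -- One majorant for all cases: the term in `KA` pays for a sample that meets only `A`, the term
    -- in `KB` for one that meets only `B`, and `2 * pairCount A B m` for one that meets both.
    let φ : ℝ → ArrivalMark N → ℝ := fun τ m => K τ + R τ + 2 * pairCount A B m +
      KA τ * pairCount A Aᶜ m + KB τ * pairCount B Bᶜ m
    have hKA : ∀ τ, 0 ≤ τ → 0 ≤ KA τ := fun τ hτ =>
      covBoundSlope_nonneg hN' (h0 A) (hle A) (h0 B) (hle B) hC hτ
    have hKB : ∀ τ, 0 ≤ τ → 0 ≤ KB τ := fun τ hτ =>
      covBoundSlope_nonneg hN' (h0 B) (hle B) (h0 A) (hle A) hC hτ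
    have hK : ∀ τ, 0 ≤ τ → 0 ≤ K τ := fun τ hτ =>
      covBound_nonneg hN' (h0 A) (hle A) (h0 B) (hle B) hC hτ
    have hpoint : ∀ τ, 0 ≤ τ → ∀ m,
        ‖evolveCov r P Z Y τ (addPoint f (τ, m)) (addPoint g (τ, m)) +
          (evolve r P Z Y τ (addPoint f (τ, m)) - evolve r P Z Y τ f) *
          (evolve r P Z Y τ (addPoint g (τ, m)) - evolve r P Z Y τ g)‖ ≤ φ τ m := by
      intro τ hτ m
      have hR : 0 ≤ R τ := by positivity
      have n1 := pairCount_nonneg A B m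
      have n2 := mul_nonneg (hKA τ hτ) (pairCount_nonneg A Aᶜ m)
      have n3 := mul_nonneg (hKB τ hτ) (pairCount_nonneg B Bᶜ m)
      have n4 := hK τ hτ
      have hf' : IsUnitValued (addPoint f (τ, m)) := hf.addPoint _
      have hg' : IsUnitValued (addPoint g (τ, m)) := hg.addPoint _
      have hfA' := hfA.addPoint (τ, m)
      have hgB' := hgB.addPoint (τ, m)
      rw [Real.norm_eq_abs]
      simp only [φ]
      by_cases hA : Disjoint A m.1
      · rw [hfA.addPoint_eq (p := (τ, m)) hA, sub_self, zero_mul, add_zero]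
        by_cases hB : Disjoint B m.1
        · rw [hgB.addPoint_eq (p := (τ, m)) hB]
          have := ih hAB hf hg hfA hgB hτ
          simp only [K, R] at *
          linarith
        · have h1 := ih (Finset.disjoint_union_right.2 ⟨hAB, hA⟩) hf hg' hfA hgB' hτ
          rw [covBound_comm] at h1
          have h2 := covBound_union_le (B := A) hN hc hC hτ hB
          rw [covBound_comm _ _ _ (B.card : ℝ)] at h2
          simp only [K, R, KB] at *
          linarith
      · by_cases hB : Disjoint B m.1
        · rw [hgB.addPoint_eq (p := (τ, m)) hB, sub_self, mul_zero, add_zero]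
          have h1 := ih (Finset.disjoint_union_left.2 ⟨hAB, hB.symm⟩) hf' hg hfA' hgB hτ
          have h2 := covBound_union_le (B := B) hN hc hC hτ hA
          simp only [K, R, KA] at *
          linarith
        -- The enlarged groups may overlap, so the induction hypothesis is unavailable; the
        -- covariance and the product are each bounded by `1`.
        · have h1 := h.abs_evolveCov_le_one hr hτ hf' hg'
          have h2 : |(evolve r P Z Y τ (addPoint f (τ, m)) - evolve r P Z Y τ f) *
              (evolve r P Z Y τ (addPoint g (τ, m)) - evolve r P Z Y τ g)| ≤ 1 := by
            rw [abs_mul]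
            exact mul_le_one₀ (abs_sub_le_one_of_mem_unit (h.evolve_mem hr hτ hf')
              (h.evolve_mem hr hτ hf)) (abs_nonneg _)
              (abs_sub_le_one_of_mem_unit (h.evolve_mem hr hτ hg') (h.evolve_mem hr hτ hg))
          have h3 := abs_add_le (evolveCov r P Z Y τ (addPoint f (τ, m)) (addPoint g (τ, m)))
            ((evolve r P Z Y τ (addPoint f (τ, m)) - evolve r P Z Y τ f) *
              (evolve r P Z Y τ (addPoint g (τ, m)) - evolve r P Z Y τ g))
          have h4 : (1 : ℝ) ≤ pairCount A B m := by
            refine le_trans ?_ (card_inter_le_pairCount B hA)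
            have : 0 < (B ∩ m.1).card :=
              Finset.card_pos.2 (Finset.not_disjoint_iff_nonempty_inter.1 hB)
            exact_mod_cast this
          linarith
    have hφi : ∀ τ, Integrable (φ τ) ρ := fun τ =>
      (((integrable_const _).add ((integrable_pairCount A B).const_mul 2)).add
        ((integrable_pairCount A Aᶜ).const_mul _)).add ((integrable_pairCount B Bᶜ).const_mul _)
    have hφ : ∀ τ, 0 ≤ τ → r * ∫ m, φ τ m ∂ρ ≤ r * K τ + r * R τ +
        C * (logistic N c A.card τ * logistic N c B.card τ) := by
      intro τ hτ
      have e : ∫ m, φ τ m ∂ρ = K τ + R τ + 2 * (∫ m, pairCount A B m ∂ρ) +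
          KA τ * (∫ m, pairCount A Aᶜ m ∂ρ) + KB τ * ∫ m, pairCount B Bᶜ m ∂ρ := by
        have j1 : Integrable (fun m => K τ + R τ + 2 * pairCount A B m) ρ :=
          (integrable_const _).add ((integrable_pairCount A B).const_mul 2)
        have j2 : Integrable (fun m => K τ + R τ + 2 * pairCount A B m +
            KA τ * pairCount A Aᶜ m) ρ := j1.add ((integrable_pairCount A Aᶜ).const_mul _)
        simp only [φ]
        rw [integral_add j2 ((integrable_pairCount B Bᶜ).const_mul _),
          integral_add j1 ((integrable_pairCount A Aᶜ).const_mul _),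
          integral_add (integrable_const _) ((integrable_pairCount A B).const_mul 2)]
        simp only [integral_const_mul, integral_const, probReal_univ, one_smul]
      have hcompl : ∀ A : Finset (Fin N), ((Aᶜ.card : ℕ) : ℝ) = N - A.card := fun A => by
        rw [Finset.card_compl, Fintype.card_fin, Nat.cast_sub]
        exact_mod_cast hle A
      have b1 := integral_pairCount_le hAB hp
      have b2 := integral_pairCount_le (disjoint_compl_right (a := A)) hp
      have b3 := integral_pairCount_le (disjoint_compl_right (a := B)) hp
      rw [hcompl] at b2 b3
      have c2 := mul_le_mul_of_nonneg_left b2 (hKA τ hτ)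
      have c3 := mul_le_mul_of_nonneg_left b3 (hKB τ hτ)
      have hsup := covBound_supersolution (c := c) (C := C) hN' (h0 A) (hle A) (h0 B) (hle B) hC
        hτ hpc hpC
      have : r * ∫ m, φ τ m ∂ρ ≤ r * (K τ + R τ + 2 * (A.card * B.card * p) +
          KA τ * (A.card * (N - A.card) * p) + KB τ * (B.card * (N - B.card) * p)) := by
        rw [e]
        refine mul_le_mul_of_nonneg_left ?_ hr.le
        linarith
      simp only [KA, KB] at this
      linarith
    have hLc := continuous_logistic (c := c) hN' (h0 A) (hle A)
    have hLc' := continuous_logistic (c := c) hN' (h0 B) (hle B)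
    have hKc : Continuous K := continuous_covBound hN' (h0 A) (hle A) (h0 B) (hle B)
    have i1 : IntervalIntegrable (fun τ => Real.exp (r * τ) *
        (r * K τ + C * (logistic N c A.card τ * logistic N c B.card τ))) volume 0 s :=
      Continuous.intervalIntegrable (by fun_prop) _ _
    have i2 : IntervalIntegrable (fun τ => r * Real.exp (r * τ) * R τ) volume 0 s :=
      Continuous.intervalIntegrable (by fun_prop) _ _
    have hmain := intervalIntegral.norm_integral_le_of_norm_le hs (g := fun τ =>
        Real.exp (r * τ) * (r * K τ + C * (logistic N c A.card τ * logistic N c B.card τ)) +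
          r * Real.exp (r * τ) * R τ)
      (f := fun τ => r * Real.exp (r * τ) *
        ∫ m, (evolveCov r P Z Y τ (addPoint f (τ, m)) (addPoint g (τ, m)) +
          (evolve r P Z Y τ (addPoint f (τ, m)) - evolve r P Z Y τ f) *
          (evolve r P Z Y τ (addPoint g (τ, m)) - evolve r P Z Y τ g)) ∂ρ) (μ := volume)
      (Filter.Eventually.of_forall fun τ hτ => by
        have hτ0 : 0 ≤ τ := hτ.1.le
        rw [norm_mul, Real.norm_of_nonneg (by positivity)]
        have b1 := norm_integral_le_of_norm_le (hφi τ)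
          (Filter.Eventually.of_forall (hpoint τ hτ0))
        calc _ ≤ r * Real.exp (r * τ) * ∫ m, φ τ m ∂ρ := by gcongr
          _ = Real.exp (r * τ) * (r * ∫ m, φ τ m ∂ρ) := by ring
          _ ≤ Real.exp (r * τ) * (r * K τ + r * R τ +
            C * (logistic N c A.card τ * logistic N c B.card τ)) := by
              gcongr; exact hφ τ hτ0
          _ = _ := by ring)
      (i1.add i2)
    -- The first part of the majorant is an exact derivative and integrates to `exp (r s) K`; the
    -- second yields the next term `(r s) ^ (n + 1) / (n + 1)!`.
    rw [← h.exp_mul_evolveCov hr hs hf hg (hbase A B hAB f g hf hg hfA hgB),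
      intervalIntegral.integral_add i1 i2,
      integral_exp_mul_covBound hN' (h0 A) (hle A) (h0 B) (hle B), norm_mul,
      Real.norm_of_nonneg (Real.exp_pos _).le, Real.norm_eq_abs] at hmain
    have hrem := integral_exp_mul_pow_le hr hs n
    have hfin : Real.exp (r * s) * |evolveCov r P Z Y s f g| ≤ Real.exp (r * s) *
        (covBound N c C A.card B.card s + (r * s) ^ (n + 1) / ((n + 1).factorial : ℝ)) := by
      rw [mul_add]
      exact hmain.trans (add_le_add_right hrem _)
    exact le_of_mul_le_mul_left hfin (Real.exp_pos _)

/-- The Picard remainder is a term of the exponential series, so it vanishes as `n` tends to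
infinity. -/
lemma abs_evolveCov_le (hN : 0 < N) (hr : 0 < r) (h : IsMarkedPoisson r ρ P Z Y)
    (hbase : ∀ (A B : Finset (Fin N)), Disjoint A B →
      ∀ f g : List (ℝ × ArrivalMark N) × InitialData ξ → ℝ, IsUnitValued f → IsUnitValued g →
      DependsOnServers pol ξ A f → DependsOnServers pol ξ B g →
      ∫ ω, f ([], Y ω) * g ([], Y ω) ∂P = (∫ ω, f ([], Y ω) ∂P) * ∫ ω, g ([], Y ω) ∂P)
    {c C p : ℝ} (hc : 0 ≤ c) (hC : 0 ≤ C) (hpc : r * p * N ≤ c) (hpC : 2 * (r * p) ≤ C)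
    (hp : ∀ i j : Fin N, i ≠ j → ρ.real {m | i ∈ m.1 ∧ j ∈ m.1} ≤ p)
    {A B : Finset (Fin N)} (hAB : Disjoint A B)
    {f g : List (ℝ × ArrivalMark N) × InitialData ξ → ℝ} (hf : IsUnitValued f)
    (hg : IsUnitValued g) (hfA : DependsOnServers pol ξ A f) (hgB : DependsOnServers pol ξ B g)
    {s : ℝ} (hs : 0 ≤ s) :
    |evolveCov r P Z Y s f g| ≤ covBound N c C A.card B.card s := by
  have h1 := (FloorSemiring.tendsto_pow_div_factorial_atTop (r * s)).const_add
    (covBound N c C A.card B.card s)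
  rw [add_zero] at h1
  exact ge_of_tendsto' h1 fun n =>
    abs_evolveCov_le_add hN hr h hbase hc hC hpc hpC hp n hAB hf hg hfA hgB hs

end Decoupling

end JSQ

/-! ### The explicit bound and the application to the queueing system -/

namespace JSQ

open Set

/-- The substitution `u = exp (c σ)` leads to the integral of `N² u / (N - 1 + u)²`. The factor `c`
on the left absorbs the Jacobian, so that `c = 0` needs no separate treatment. -/
lemma mul_integral_logistic_one_sq {N c s : ℝ} (hN : 1 ≤ N) :
    c * ∫ σ in 0..s, logistic N c 1 σ * logistic N c 1 σ =
      N * (N * Real.log ((N + Real.exp (c * s) - 1) / N) -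
        (N - 1) * (Real.exp (c * s) - 1) / (N + Real.exp (c * s) - 1)) := by
  have hN0 : 0 < N := by linarith
  have hden : ∀ σ, 0 < N + Real.exp (c * σ) - 1 := fun σ => by
    have := Real.exp_pos (c * σ); linarith
  have hd : ∀ σ ∈ uIcc 0 s, HasDerivAt (fun σ => N * (N * Real.log ((N + Real.exp (c * σ) - 1) / N)
      - (N - 1) * (Real.exp (c * σ) - 1) / (N + Real.exp (c * σ) - 1)))
      (c * (logistic N c 1 σ * logistic N c 1 σ)) σ := fun σ _ => by
    have h0 := hden σ
    have h1 : HasDerivAt (fun s => Real.exp (c * s)) (Real.exp (c * σ) * c) σ := by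
      simpa using ((hasDerivAt_id σ).const_mul c).exp
    have h2 := (h1.const_add N).sub_const 1
    have h3 := ((h2.div_const N).log (by positivity)).const_mul N
    have h4 := ((h1.sub_const 1).const_mul (N - 1)).fun_div h2 h0.ne'
    convert! (h3.fun_sub h4).const_mul N using 1
    have e : N - 1 + 1 * Real.exp (c * σ) = N + Real.exp (c * σ) - 1 := by ring
    unfold logistic
    rw [e]
    field_simp
    ring
  rw [← intervalIntegral.integral_const_mul, intervalIntegral.integral_eq_sub_of_hasDerivAt hd]
  · simp [hN0.ne']
  · have h1 := continuous_logistic (c := c) hN0 zero_le_one hN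
    exact Continuous.intervalIntegrable (by fun_prop) _ _

section Driving

variable {N D : ℕ} {lam : ℝ} {ν : Measure (ℝ≥0 × ℝ)} {ξ : Fin N → ℕ} {pol : ServicePolicy}
  {Ω : Type*} [MeasurableSpace Ω] {P : Measure Ω}
  {Z : ℕ → Ω → ArrivalData N} {Y : (i : Fin N) → Ω → (Fin (ξ i) → ℝ≥0 × ℝ)}

lemma IsDriving.isMarkedPoisson (h : IsDriving D lam ν ξ P Z Y) :
    IsMarkedPoisson (lam * N) (markLaw N D ν) P Z (fun ω i => Y i ω) :=
  ⟨h.measurable_arrivals, measurable_pi_lambda _ h.measurable_initial,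
    fun n => (h.law_arrivals n).map_eq, h.indep_arrivals, h.indep_initial_arrivals⟩

/-- Without arrivals, functions of disjoint groups see the initial tasks of disjoint sets of
servers, which are independent. This starts the renewal equation for covariances. -/
lemma IsDriving.integral_mul_initial (h : IsDriving D lam ν ξ P Z Y) (A B : Finset (Fin N))
    (hAB : Disjoint A B) (f g : List (ℝ × ArrivalMark N) × InitialData ξ → ℝ)
    (hf : IsUnitValued f) (hg : IsUnitValued g) (hfA : DependsOnServers pol ξ A f)
    (hgB : DependsOnServers pol ξ B g) :
    ∫ ω, f ([], fun i => Y i ω) * g ([], fun i => Y i ω) ∂P =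
      (∫ ω, f ([], fun i => Y i ω) ∂P) * ∫ ω, g ([], fun i => Y i ω) ∂P := by
  classical
  have hind := h.indep_initial.indepFun_finset A B hAB h.measurable_initial
  -- The value `0` outside `A` is harmless, because only functions depending on the servers in `A`
  -- are composed with `ext A`.
  let ext (A : Finset (Fin N)) (v : (i : A) → Fin (ξ i) → ℝ≥0 × ℝ) : InitialData ξ :=
    fun i => if hi : i ∈ A then v ⟨i, hi⟩ else 0
  have hext : ∀ A, Measurable (ext A) := fun A => measurable_pi_lambda _ fun i => by
    by_cases hi : i ∈ A
    · simp only [ext, hi, dite_true]; exact measurable_pi_apply _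
    · simp only [ext, hi, dite_false]; exact measurable_const
  have hφ : ∀ {f : List (ℝ × ArrivalMark N) × InitialData ξ → ℝ} (A : Finset (Fin N)),
      IsUnitValued f → Measurable fun v => f ([], ext A v) := fun A hf =>
    hf.measurable.comp (measurable_const.prodMk (hext A))
  have he : ∀ {f : List (ℝ × ArrivalMark N) × InitialData ξ → ℝ} {A : Finset (Fin N)},
      DependsOnServers pol ξ A f → ∀ ω, f ([], fun i => Y i ω) =
        f ([], ext A fun i => Y i ω) := fun hfA ω =>
    hfA.nil_congr fun j hj => by simp [ext, hj]
  simp only [he hfA, he hgB]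
  have hm : ∀ A : Finset (Fin N), Measurable fun ω (i : A) => Y i ω := fun A =>
    measurable_pi_lambda _ fun i => h.measurable_initial i
  exact (hind.comp (hφ A hf) (hφ B hg)).integral_mul_eq_mul_integral
    ((hφ A hf).comp (hm A)).aestronglyMeasurable ((hφ B hg).comp (hm B)).aestronglyMeasurable

/-- The indicator of the event that server `i` has at least `k` tasks at time `t`, as a function of
the arrivals in `[0, t]` and of the initial tasks. -/
noncomputable def queueIndicator (pol : ServicePolicy) (ξ : Fin N → ℕ) (k : ℕ) (t : ℝ) (i : Fin N)
    (q : List (ℝ × ArrivalMark N) × InitialData ξ) : ℝ :=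
  if k ≤ pol.queueLength (route pol ξ q.1 q.2 i) t then 1 else 0

lemma isUnitValued_queueIndicator (k : ℕ) (t : ℝ) (i : Fin N) :
    IsUnitValued (queueIndicator pol ξ k t i) := by
  refine ⟨?_, fun q => ?_, fun q => ?_⟩
  · refine Measurable.ite (measurableSet_le measurable_const ?_) measurable_const measurable_const
    exact measurable_queueLength.comp ((measurable_route i).prodMk measurable_const)
  · unfold queueIndicator; split_ifs <;> simp
  · unfold queueIndicator; split_ifs <;> simp

lemma dependsOnServers_queueIndicator (k : ℕ) (t : ℝ) (i : Fin N) :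
    DependsOnServers pol ξ {i} (queueIndicator pol ξ k t i) := fun L y L' y' h => by
  simp only [queueIndicator, h i (Finset.mem_singleton_self i)]

omit [MeasurableSpace Ω] in
lemma tailProcess_eq_sum (k : ℕ) (t : ℝ) (ω : Ω) :
    tailProcess pol ξ Z Y k t ω =
      ∑ i, queueIndicator pol ξ k t i (histUpTo Z t ω, fun i => Y i ω) := by
  rw [tailProcess, tailCount, Finset.card_filter]
  push_cast
  refine Finset.sum_congr rfl fun i _ => ?_
  rw [queue, routed_eq, arrivalCount_eq]
  rfl

/-- The bound for the probability that two given servers are sampled is compatible with the rate in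
`uFun` and with the prefactor of the covariance bound. -/
lemma rate_bounds (hD : 1 ≤ D) (hDN : D < N) (hlam : 0 < lam) :
    lam * N * ((D * (D - 1) : ℝ) / (N * (N - 1))) * N ≤
        (2 : ℝ) ^ (D - 1) * lam * D * N / ((N : ℝ) - D) ∧
      2 * (lam * N * ((D * (D - 1) : ℝ) / (N * (N - 1)))) ≤ 2 * (3 / 2 : ℝ) ^ D / ((N : ℝ) - D) *
        ((2 : ℝ) ^ (D - 1) * lam * D * N / ((N : ℝ) - D)) := by
  have hD' : (1 : ℝ) ≤ D := by exact_mod_cast hD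
  have hDN' : (D : ℝ) + 1 ≤ N := by exact_mod_cast hDN
  have hpow : (D : ℝ) - 1 ≤ 2 ^ (D - 1) := by
    have h1 : D - 1 < 2 ^ (D - 1) := Nat.lt_two_pow_self
    have h2 : ((D - 1 : ℕ) : ℝ) ≤ 2 ^ (D - 1) := by exact_mod_cast h1.le
    rwa [Nat.cast_sub hD, Nat.cast_one] at h2
  have hpow' : (1 : ℝ) ≤ (3 / 2) ^ D := one_le_pow₀ (by norm_num)
  have hN0 : (0 : ℝ) < N := by linarith
  have hN1 : (0 : ℝ) < N - 1 := by linarith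
  have hND : (0 : ℝ) < N - D := by linarith
  have hp2 : (0 : ℝ) < 2 ^ (D - 1) := by positivity
  have e1 : lam * N * ((D * (D - 1) : ℝ) / (N * (N - 1))) * N =
      lam * D * N * (((D : ℝ) - 1) / (N - 1)) := by field_simp
  have e2 : (2 : ℝ) ^ (D - 1) * lam * D * N / ((N : ℝ) - D) =
      lam * D * N * (2 ^ (D - 1) / (N - D)) := by field_simp
  -- The comparison uses only `D - 1 ≤ 2 ^ (D - 1)` and `N - D ≤ N - 1`. The prefactor bound below
  -- has further room, from `N - D ≤ N` and `1 ≤ (3/2) ^ D`.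
  have key : ((D : ℝ) - 1) / (N - 1) ≤ 2 ^ (D - 1) / (N - D) :=
    div_le_div₀ hp2.le hpow hND (by linarith)
  have h1 : lam * N * ((D * (D - 1) : ℝ) / (N * (N - 1))) * N ≤
      (2 : ℝ) ^ (D - 1) * lam * D * N / ((N : ℝ) - D) := by
    rw [e1, e2]
    exact mul_le_mul_of_nonneg_left key (by positivity)
  refine ⟨h1, ?_⟩
  set X := lam * N * ((D * (D - 1) : ℝ) / (N * (N - 1)))
  set c := (2 : ℝ) ^ (D - 1) * lam * D * N / ((N : ℝ) - D)
  have hc : 0 ≤ c := by positivity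
  have h2 : X ≤ c / N := by rw [le_div_iff₀ hN0]; exact h1
  have h3 : c / N ≤ c / (N - D) := div_le_div_of_nonneg_left hc hND (by linarith)
  have h4 : c / (N - D) ≤ (3 / 2 : ℝ) ^ D * (c / (N - D)) :=
    le_mul_of_one_le_left (by positivity) hpow'
  calc 2 * X ≤ 2 * ((3 / 2 : ℝ) ^ D * (c / (N - D))) := by linarith
    _ = _ := by ring

end Driving

end JSQ

theorem proposition2p3 (N D : ℕ) (hD : 1 ≤ D) (hDN : D < N)
    (lam : ℝ) (hlam : 0 < lam) (hlam_lt : lam < 1)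
    (ν : Measure (ℝ≥0 × ℝ)) [IsProbabilityMeasure ν] (pol : JSQ.ServicePolicy)
    (ξ : Fin N → ℕ)
    {Ω : Type*} [MeasurableSpace Ω] (P : Measure Ω) [IsProbabilityMeasure P]
    (Z : ℕ → Ω → JSQ.ArrivalData N) (Y : (i : Fin N) → Ω → (Fin (ξ i) → ℝ≥0 × ℝ))
    (hZY : JSQ.IsDriving D lam ν ξ P Z Y)
    (t : ℝ) (ht : 0 ≤ t) (k l : ℕ) :
    Integrable (fun ω => JSQ.tailProcess pol ξ Z Y k t ω) P ∧
    Integrable (fun ω => JSQ.tailProcess pol ξ Z Y l t ω) P ∧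
    Integrable (fun ω => JSQ.tailProcess pol ξ Z Y k t ω * JSQ.tailProcess pol ξ Z Y l t ω) P ∧
    |(∫ ω, JSQ.tailProcess pol ξ Z Y k t ω * JSQ.tailProcess pol ξ Z Y l t ω ∂P)
        - (∫ ω, JSQ.tailProcess pol ξ Z Y k t ω ∂P)
          * (∫ ω, JSQ.tailProcess pol ξ Z Y l t ω ∂P)|
      ≤ 2 * (3 / 2 : ℝ) ^ D * (N : ℝ) ^ 2 * ((N : ℝ) - 1) / ((N : ℝ) - D)
          * ((N : ℝ) * Real.log (((N : ℝ) + JSQ.uFun N D lam t - 1) / N)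
            - ((N : ℝ) - 1) * (JSQ.uFun N D lam t - 1) / ((N : ℝ) + JSQ.uFun N D lam t - 1))
        + N := by
  classical
  have hN : 0 < N := by omega
  have hN1 : (1 : ℝ) ≤ N := by exact_mod_cast hN
  have hDN' : (0 : ℝ) < (N : ℝ) - D := by
    have : (D : ℝ) < N := by exact_mod_cast hDN
    linarith
  have hr : 0 < lam * N := by positivity
  have hρ := JSQ.isProbabilityMeasure_markLaw hDN.le ν
  have hM := hZY.isMarkedPoisson
  -- Here `exp (c t)` is `uFun N D lam t`, and `C` contains the factor `c` that the explicit
  -- logistic integral requires; the rest of `C` is the prefactor of the claim divided by `N ^ 2 *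
  -- (N - 1)`.
  let c : ℝ := (2 : ℝ) ^ (D - 1) * lam * D * N / ((N : ℝ) - D)
  let C : ℝ := 2 * (3 / 2 : ℝ) ^ D / ((N : ℝ) - D) * c
  have hc : 0 ≤ c := by positivity
  have hC : 0 ≤ C := by positivity
  obtain ⟨hpc, hpC⟩ := JSQ.rate_bounds hD hDN hlam
  have hp : ∀ i j : Fin N, i ≠ j → (JSQ.markLaw N D ν).real {m | i ∈ m.1 ∧ j ∈ m.1} ≤
      (D * (D - 1) : ℝ) / (N * (N - 1)) := fun i j hij => by
    have e : {m : JSQ.ArrivalMark N | i ∈ m.1 ∧ j ∈ m.1} =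
        {S : Finset (Fin N) | i ∈ S ∧ j ∈ S} ×ˢ Set.univ := by
      ext m; simp
    have := JSQ.isProbabilityMeasure_sampling (N := N) hDN.le
    rw [e, JSQ.markLaw, measureReal_prod_prod, probReal_univ, mul_one]
    exact JSQ.sampling_pair_le hDN.le hij
  let X : ℕ → Fin N → Ω → ℝ := fun k i ω =>
    JSQ.queueIndicator pol ξ k t i (JSQ.histUpTo Z t ω, fun i => Y i ω)
  have hX : ∀ k, (fun ω => JSQ.tailProcess pol ξ Z Y k t ω) = fun ω => ∑ i, X k i ω := fun k =>
    funext fun ω => JSQ.tailProcess_eq_sum k t ω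
  have hu := fun k i => JSQ.isUnitValued_queueIndicator (pol := pol) (ξ := ξ) k t i
  have hint : ∀ k i, Integrable (X k i) P := fun k i => hM.integrable_histUpTo hr ht (hu k i)
  have hint2 : ∀ i j, Integrable (fun ω => X k i ω * X l j ω) P := fun i j =>
    hM.integrable_histUpTo hr ht ((hu k i).mul (hu l j))
  have hXX : (fun ω => JSQ.tailProcess pol ξ Z Y k t ω * JSQ.tailProcess pol ξ Z Y l t ω) =
      fun ω => ∑ i, ∑ j, X k i ω * X l j ω := by
    ext ω
    rw [JSQ.tailProcess_eq_sum, JSQ.tailProcess_eq_sum, Finset.sum_mul_sum]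
  refine ⟨?_, ?_, ?_, ?_⟩
  · rw [hX k]; exact integrable_finsetSum _ fun i _ => hint k i
  · rw [hX l]; exact integrable_finsetSum _ fun i _ => hint l i
  · rw [hXX]
    exact integrable_finsetSum _ fun i _ => integrable_finsetSum _ fun j _ => hint2 i j
  have hcov : (∫ ω, JSQ.tailProcess pol ξ Z Y k t ω * JSQ.tailProcess pol ξ Z Y l t ω ∂P)
        - (∫ ω, JSQ.tailProcess pol ξ Z Y k t ω ∂P) * (∫ ω, JSQ.tailProcess pol ξ Z Y l t ω ∂P) =
      ∑ i, ∑ j, JSQ.evolveCov (lam * N) P Z (fun ω i => Y i ω) t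
        (JSQ.queueIndicator pol ξ k t i) (JSQ.queueIndicator pol ξ l t j) := by
    rw [hXX, hX k, hX l,
      integral_finsetSum _ fun i _ => integrable_finsetSum _ fun j _ => hint2 i j,
      integral_finsetSum _ fun i _ => hint k i, integral_finsetSum _ fun i _ => hint l i,
      Finset.sum_mul_sum, ← Finset.sum_sub_distrib]
    refine Finset.sum_congr rfl fun i _ => ?_
    rw [integral_finsetSum _ fun j _ => hint2 i j, ← Finset.sum_sub_distrib]
    refine Finset.sum_congr rfl fun j _ => ?_
    rw [JSQ.evolveCov, hM.evolve_eq_integral hr ht ((hu k i).mul (hu l j)),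
      hM.evolve_eq_integral hr ht (hu k i), hM.evolve_eq_integral hr ht (hu l j)]
  have hKnonneg : 0 ≤ JSQ.covBound N c C 1 1 t :=
    JSQ.covBound_nonneg (by linarith) zero_le_one hN1 zero_le_one hN1 hC ht
  have hterm : ∀ i j : Fin N, |JSQ.evolveCov (lam * N) P Z (fun ω i => Y i ω) t
        (JSQ.queueIndicator pol ξ k t i) (JSQ.queueIndicator pol ξ l t j)| ≤
      if i = j then 1 else JSQ.covBound N c C 1 1 t := by
    intro i j
    -- On the diagonal the two groups coincide and only the trivial bound is available; these `N`
    -- terms produce the summand `N` of the claim.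
    split_ifs with hij
    · exact hM.abs_evolveCov_le_one hr ht (hu k i) (hu l j)
    · have := JSQ.abs_evolveCov_le hN hr hM hZY.integral_mul_initial hc hC hpc hpC hp
        (Finset.disjoint_singleton.2 hij) (hu k i) (hu l j)
        (JSQ.dependsOnServers_queueIndicator (pol := pol) k t i)
        (JSQ.dependsOnServers_queueIndicator l t j) ht
      simpa using this
  have hK : JSQ.covBound N c C 1 1 t = 2 * (3 / 2 : ℝ) ^ D / ((N : ℝ) - D) *
      (N * ((N : ℝ) * Real.log (((N : ℝ) + JSQ.uFun N D lam t - 1) / N)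
            - ((N : ℝ) - 1) * (JSQ.uFun N D lam t - 1) / ((N : ℝ) + JSQ.uFun N D lam t - 1))) := by
    rw [JSQ.covBound, mul_assoc, JSQ.mul_integral_logistic_one_sq hN1]
    rfl
  rw [hcov]
  calc _ ≤ ∑ i : Fin N, ∑ j : Fin N, if i = j then 1 else JSQ.covBound N c C 1 1 t :=
        (Finset.abs_sum_le_sum_abs _ _).trans (Finset.sum_le_sum fun i _ =>
          (Finset.abs_sum_le_sum_abs _ _).trans (Finset.sum_le_sum fun j _ => hterm i j))
    _ = N * (N - 1) * JSQ.covBound N c C 1 1 t + N := by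
        have e : ∀ i : Fin N, (∑ j : Fin N, if i = j then 1 else JSQ.covBound N c C 1 1 t) =
            (N - 1) * JSQ.covBound N c C 1 1 t + 1 := fun i => by
          have e1 : ∀ j : Fin N, (if i = j then (1 : ℝ) else JSQ.covBound N c C 1 1 t) =
              JSQ.covBound N c C 1 1 t + if i = j then 1 - JSQ.covBound N c C 1 1 t else 0 :=
            fun j => by split_ifs <;> ring
          simp only [e1, Finset.sum_add_distrib, Finset.sum_ite_eq, Finset.mem_univ, if_true,
            Finset.sum_const, Finset.card_univ, Fintype.card_fin, nsmul_eq_mul]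
          ring
        simp only [e, Finset.sum_const, Finset.card_univ, Fintype.card_fin, nsmul_eq_mul]
        ring
    _ = _ := by rw [hK]; ring
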